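/- Let $k$ be a field, $n\in\mathbb N$, $A=k[x_1,\dots,x_n]/\langle x_1\cdots x_n\rangle$ and $A^e=A\otimes_k A$, acting on $A$ by $(a\otimes b)\cdot c=acb$. For $I\subseteq[n]=\{1,\dots,n\}$ and $i\in[n]$ put $\mathrm{sgn}(i,I)=(-1)^{|\{j\in I\,:\,j<i\}|}$, and $\mathrm{sgn}(I,J)=\prod_{i\in I}\mathrm{sgn}(i,J)$; thus $e_I\wedge e_J=\mathrm{sgn}(I,J)\,e_{I\cup J}$ when $I\cap J=\emptyset$. Let $F_m$ be the free $A^e$-module with basis the symbols $e_It^{(q)}$, where $I\subseteq[n]$, $q\ge 0$ and $|I|+2q=m$. Let $d:F_{m+1}\to F_m$ be the $A^e$-linear map with $$d(e_It^{(q)})=\sum_{i\in I}\mathrm{sgn}(i,I)(1\otimes x_i-x_i\otimes 1)\,e_{I\smallsetminus\{i\}}t^{(q)}+\sum_{i\notin I}\mathrm{sgn}(i,I)\,(x_1\cdots x_{i-1}\otimes x_{i+1}\cdots x_n)\,e_{I\cup\{i\}}t^{(q-1)},$$ where the second sum is omitted if $q=0$. Let $\epsilon:F_0=A^e\to A$ be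 $a\otimes b\mapsto ab$, and let $\mathrm{HH}^m(A)=H^m(\mathrm{Hom}_{A^e}(F_\bullet,A))$. For $\alpha\in\mathbb N^n$ and $|I|+2q=m$, let $(e_It^{(q)},\mathbf x^\alpha)\in\mathrm{Hom}_{A^e}(F_m,A)$ be the standard cochain that sends $e_It^{(q)}$ to $\mathbf x^\alpha$ and all other basis elements to $0$; the same notation is used for its class if it is a cocycle. For cocycles $f:F_i\to A$ and $g:F_j\to A$, the cup (Yoneda) product $f\smile g$ is the class of $g\circ\tilde f_j$ in $\mathrm{HH}^{i+j}(A)$, where $\tilde f_m:F_{i+m}\to F_m$ $(m\ge 0)$ are $A^e$-linear maps with $\epsilon\tilde f_0=f$ and $d\tilde f_{m+1}=\tilde f_m d$ for all $m\geq 0$. **Proposition.** Such lifts exist, and $f\smile g$ depends only on the classes of $f$ and $g$. If $f=(e_It^{(p)},\mathbf x^\alpha)$ and $g=(e_Jt^{(q)},\mathbf x^\beta)$ are cocycles, of degrees $i=|I|+2p$ and $j=|J|+2q$, then in $\mathrm{HH}^{i+j}(A)$ $$f\smile g=\begin{cases}\mathrm{sgn}(J,I)\cdot(e_{I\cup J}t^{(p+q)},\mathbf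 x^{\alpha+\beta}), & \text{if } I\cap J=\emptyset,\\ 0,&\text{otherwise,}\end{cases}$$ where, if $I\cap J=\emptyset$, the cochain on the right is again a cocycle and $\mathrm{sgn}(J,I)=(-1)^{ij}\,\mathrm{sgn}(I,J)$. Moreover, the product is graded-commutative: $b\smile a=(-1)^{ij}\,a\smile b$ for all $a\in\mathrm{HH}^i(A)$ and $b\in\mathrm{HH}^j(A)$. -/

import Mathlib

open scoped TensorProduct

namespace SqfreeHH

universe u

/-- The algebra `A = k[x₁,…,xₙ] / ⟨x₁ ⋯ xₙ⟩`. -/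
def Alg (k : Type u) [Field k] (n : ℕ) : Type u :=
  MvPolynomial (Fin n) k ⧸ Ideal.span {∏ i : Fin n, (MvPolynomial.X i : MvPolynomial (Fin n) k)}

noncomputable instance (k : Type u) [Field k] (n : ℕ) : CommRing (Alg k n) :=
  inferInstanceAs (CommRing (MvPolynomial (Fin n) k ⧸
    Ideal.span {∏ i : Fin n, (MvPolynomial.X i : MvPolynomial (Fin n) k)}))

noncomputable instance (k : Type u) [Field k] (n : ℕ) : Algebra k (Alg k n) :=
  inferInstanceAs (Algebra k (MvPolynomial (Fin n) k ⧸
    Ideal.span {∏ i : Fin n, (MvPolynomial.X i : MvPolynomial (Fin n) k)}))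

noncomputable instance (k : Type u) [Field k] (n : ℕ) : AddCommMonoid (Alg k n) :=
  AddCommGroup.toAddCommMonoid

/-- The quotient map `k[x₁,…,xₙ] → A`. -/
noncomputable def proj (k : Type u) [Field k] (n : ℕ) : MvPolynomial (Fin n) k →ₐ[k] Alg k n :=
  Ideal.Quotient.mkₐ k
    (Ideal.span {∏ i : Fin n, (MvPolynomial.X i : MvPolynomial (Fin n) k)})

/-- The enveloping algebra `A ⊗ₖ A` (`A` is commutative, so `Aᵒᵖ = A`). -/
def Env (k : Type u) [Field k] (n : ℕ) : Type u := Alg k n ⊗[k] Alg k n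

noncomputable instance (k : Type u) [Field k] (n : ℕ) : CommRing (Env k n) :=
  inferInstanceAs (CommRing (Alg k n ⊗[k] Alg k n))

noncomputable instance (k : Type u) [Field k] (n : ℕ) : Algebra k (Env k n) :=
  inferInstanceAs (Algebra k (Alg k n ⊗[k] Alg k n))

/-- The element `a ⊗ b` of `A ⊗ A`. -/
noncomputable def tens {k : Type u} [Field k] {n : ℕ} (a b : Alg k n) : Env k n := a ⊗ₜ[k] b

/-- The multiplication map `A ⊗ A → A`, `a ⊗ b ↦ a b`. -/
noncomputable def mulMap (k : Type u) [Field k] (n : ℕ) : Env k n →ₐ[k] Alg k n :=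
  Algebra.TensorProduct.lmul' k (S := Alg k n)

theorem mulMap_tens {k : Type u} [Field k] {n : ℕ} (a b : Alg k n) :
    mulMap k n (tens a b) = a * b :=
  Algebra.TensorProduct.lmul'_apply_tmul a b

/-- `A` as a module over its enveloping algebra: `(a ⊗ b) • c = a * c * b`. -/
noncomputable instance envModule (k : Type u) [Field k] (n : ℕ) : Module (Env k n) (Alg k n) :=
  Module.compHom (Alg k n) (mulMap k n).toRingHom

theorem tens_smul {k : Type u} [Field k] {n : ℕ} (a b c : Alg k n) :
    tens a b • c = a * c * b := by
  change mulMap k n (tens a b) * c = a * c * b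
  rw [mulMap_tens]
  ring

/-- The class in `A` of the monomial `x^α`. -/
noncomputable def mon (k : Type u) [Field k] {n : ℕ} (α : Fin n →₀ ℕ) : Alg k n :=
  proj k n (MvPolynomial.monomial α 1)

/-- The class in `A` of the variable `x_i`. -/
noncomputable def var (k : Type u) [Field k] {n : ℕ} (i : Fin n) : Alg k n :=
  proj k n (MvPolynomial.X i)

/-- `sgn(i, I) = (-1)^{#{j ∈ I | j < i}}`. -/
def sgnElt {n : ℕ} (i : Fin n) (I : Finset (Fin n)) : ℤ :=
  (-1) ^ (I.filter (fun j => j < i)).card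

/-- `sgn(I, J) = (-1)^{#{(i, j) ∈ I × J | j < i}}`: for disjoint `I`, `J` it is the sign with
`e_I ∧ e_J = sgn(I, J) e_{I ∪ J}`. -/
def sgn {n : ℕ} (I J : Finset (Fin n)) : ℤ := ∏ i ∈ I, sgnElt i J

/-- The basis symbols `e_I t^{(q)}` of degree `|I| + 2q = m`. -/
abbrev Gen (n m : ℕ) : Type := {b : Finset (Fin n) × ℕ // b.1.card + 2 * b.2 = m}

/-- The free `A ⊗ A`-module `F_m` on the symbols `e_I t^{(q)}` of degree `m`. -/
abbrev F (k : Type u) [Field k] (n m : ℕ) : Type u := Gen n m →₀ Env k n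

/-- The element `e_I t^{(q)}` of `F_m` (used only when its degree is `m`; it is `0` otherwise). -/
noncomputable def gen (k : Type u) [Field k] {n : ℕ} (m : ℕ) (I : Finset (Fin n)) (q : ℕ) :
    F k n m :=
  if h : I.card + 2 * q = m then Finsupp.single ⟨(I, q), h⟩ 1 else 0

/-- `1 ⊗ x_i - x_i ⊗ 1`. -/
noncomputable def delta (k : Type u) [Field k] {n : ℕ} (i : Fin n) : Env k n :=
  tens 1 (var k i) - tens (var k i) 1

/-- `x_1 ⋯ x_{i-1} ⊗ x_{i+1} ⋯ x_n`. -/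
noncomputable def split (k : Type u) [Field k] {n : ℕ} (i : Fin n) : Env k n :=
  tens (∏ j ∈ Finset.univ.filter (fun j => j < i), var k j)
    (∏ j ∈ Finset.univ.filter (fun j => i < j), var k j)

/-- The differential `d_{m+1} : F_{m+1} → F_m`, with
`d(e_I t^{(q)}) = ∑_{i ∈ I} sgn(i, I) (1 ⊗ x_i - x_i ⊗ 1) e_{I ∖ i} t^{(q)}
  + ∑_i (x_1 ⋯ x_{i-1} ⊗ x_{i+1} ⋯ x_n) (e_i ∧ e_I) t^{(q-1)}`,
the second sum being present only for `q ≥ 1`. Here `e_i ∧ e_I` is `0` for `i ∈ I` and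
`sgn(i, I) e_{I ∪ i}` for `i ∉ I`. -/
noncomputable def d (k : Type u) [Field k] (n m : ℕ) : F k n (m + 1) →ₗ[Env k n] F k n m :=
  Finsupp.linearCombination (Env k n) fun b : Gen n (m + 1) =>
    (∑ i ∈ b.1.1, sgnElt i b.1.1 • (delta k i • gen k m (b.1.1.erase i) b.1.2)) +
    (if 1 ≤ b.1.2 then
      ∑ i ∈ b.1.1ᶜ, sgnElt i b.1.1 • (split k i • gen k m (insert i b.1.1) (b.1.2 - 1))
    else 0)

/-- The augmentation `ε : F_0 → A`, `a ⊗ b ↦ a b`, where `F_0` is free on `e_∅ t^{(0)}`. -/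
noncomputable def aug (k : Type u) [Field k] (n : ℕ) : F k n 0 →ₗ[Env k n] Alg k n :=
  Finsupp.linearCombination (Env k n) fun _ : Gen n 0 => (1 : Alg k n)

/-- The degree `m` cochains `Hom(F_m, A)`, homomorphisms of `A ⊗ A`-modules. -/
abbrev Cochain (k : Type u) [Field k] (n m : ℕ) : Type u := F k n m →ₗ[Env k n] Alg k n

/-- The coboundary `Hom(F_m, A) → Hom(F_{m+1}, A)`, `f ↦ f ∘ d`. -/
noncomputable def dStar (k : Type u) [Field k] (n m : ℕ) :
    Cochain k n m →ₗ[Env k n] Cochain k n (m + 1) :=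
  LinearMap.lcomp (Env k n) (Alg k n) (d k n m)

/-- Cocycles of degree `m`. -/
noncomputable def cocycles (k : Type u) [Field k] (n m : ℕ) :
    Submodule (Env k n) (Cochain k n m) :=
  LinearMap.ker (dStar k n m)

/-- Coboundaries of degree `m` (zero in degree `0`). -/
noncomputable def coboundaries (k : Type u) [Field k] (n : ℕ) :
    (m : ℕ) → Submodule (Env k n) (Cochain k n m)
  | 0 => ⊥
  | m + 1 => LinearMap.range (dStar k n m)

/-- Hochschild cohomology `HH^m(A)`: cocycles modulo coboundaries in `Hom(F_•, A)`. -/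
abbrev HH (k : Type u) [Field k] (n m : ℕ) : Type u :=
  cocycles k n m ⧸ (coboundaries k n m).submoduleOf (cocycles k n m)

/-- The class of a cocycle. -/
noncomputable def cls {k : Type u} [Field k] {n m : ℕ} (f : Cochain k n m)
    (hf : f ∈ cocycles k n m) : HH k n m :=
  Submodule.Quotient.mk ⟨f, hf⟩

/-- Transport of classes along an equality of degrees. -/
def HH.cast {k : Type u} [Field k] {n m m' : ℕ} (h : m = m') (c : HH k n m) : HH k n m' :=
  h ▸ c

/-- The standard cochain `(e_I t^{(q)}, x^α)` in degree `m = |I| + 2q`: it sends `e_I t^{(q)}` to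
`x^α` and all other basis elements of `F_m` to `0`. -/
noncomputable def std (k : Type u) [Field k] {n : ℕ} (m : ℕ) (I : Finset (Fin n)) (q : ℕ)
    (α : Fin n →₀ ℕ) : Cochain k n m :=
  Finsupp.linearCombination (Env k n) fun b : Gen n m =>
    if b.1 = (I, q) then mon k α else 0

/-- A family `φ_m : F_{i+m} → F_m` is a lift of `f : F_i → A` if it is a chain map over `f`:
`ε ∘ φ_0 = f` and `d ∘ φ_{m+1} = φ_m ∘ d`. -/
structure IsLift {k : Type u} [Field k] {n i : ℕ} (f : Cochain k n i)
    (φ : (m : ℕ) → F k n (i + m) →ₗ[Env k n] F k n m) : Prop where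
  aug_comp : aug k n ∘ₗ φ 0 = f
  comm : ∀ m : ℕ, d k n m ∘ₗ φ (m + 1) = φ m ∘ₗ d k n (i + m)

theorem IsLift.comp_mem {k : Type u} [Field k] {n i j : ℕ} {f : Cochain k n i}
    {φ : (m : ℕ) → F k n (i + m) →ₗ[Env k n] F k n m} (hφ : IsLift f φ)
    {g : Cochain k n j} (hg : g ∈ cocycles k n j) :
    g ∘ₗ φ j ∈ cocycles k n (i + j) := by
  have hg' : g ∘ₗ d k n j = 0 := hg
  change (g ∘ₗ φ j) ∘ₗ d k n (i + j) = 0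
  rw [LinearMap.comp_assoc, ← hφ.comm j, ← LinearMap.comp_assoc, hg', LinearMap.zero_comp]

/-- `c` is a value of the cup (Yoneda) product `a ⌣ b`: for some cocycles `f`, `g` representing
`a`, `b` and some chain map `φ` lifting `f`, `c` is the class of `g ∘ φ_j`. -/
def IsCup {k : Type u} [Field k] {n i j : ℕ} (a : HH k n i) (b : HH k n j)
    (c : HH k n (i + j)) : Prop :=
  ∃ (f : Cochain k n i) (hf : f ∈ cocycles k n i) (g : Cochain k n j) (hg : g ∈ cocycles k n j)
    (φ : (m : ℕ) → F k n (i + m) →ₗ[Env k n] F k n m) (hφ : IsLift f φ),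
    cls f hf = a ∧ cls g hg = b ∧ c = cls (g ∘ₗ φ j) (hφ.comp_mem hg)

end SqfreeHH

/-!
The complex `F` is Tate's resolution of `A` over `A ⊗ A`. Writing `ι_i` and `e_i` for contraction
and multiplication by `e_i`, and `T` for the operator lowering the divided power `t^{(q)}`, its
differential is `D = ∑ δ_i ι_i + (∑ s_i e_i) T`, with `δ_i = 1 ⊗ x_i - x_i ⊗ 1` and `s_i` the mixed
products. The calculus of `ι_i`, `e_i`, `T` (`contr`, `wedge`, `lower`) takes place on families of
coefficients in all degrees at once, over an arbitrary commutative ring, where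
`D² = (∑ δ_i s_i) T` (`tate_tate`) and `∑ δ_i s_i` telescopes.

*Exactness.* `A ⊗ A` is the quotient of `A[X_1, …, X_n]` by the nonzerodivisor
`f = X_1 ⋯ X_n = ∑ (X_i - x_i) s_i` (`prod_X_dvd_of_envPres_eq_zero`), and the Koszul complex on
the weakly regular sequence `X_i - x_i` is exact (`exists_koszul_eq_of_regular`). A cycle over
`A ⊗ A` lifts to some `z` with `D z = f w`, and `D² = f T` turns it into a Koszul cycle
(`exists_tate_eq`). Hence chain maps over coboundaries are null-homotopic up to maps through `d`,
which makes the cup product single-valued (`IsCup.unique`).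

*Explicit lifts.* The operator `x_i ι_i` does not anticommute with `D`, but
`x_i ι_i + ∑_{l ≤ i} s_l e_l T` does (`tate_euler`), again by telescoping. A cochain is a cocycle
exactly when its value on each `e_I t^{(q)}` is divisible by `∏_{i ∈ I} x_i`
(`cofactor_mul_apply_eq_zero`, `exists_eq_varProd_mul`), so composites of these operators with
powers of `T` provide lifts of all cocycles. When such a lift is followed by a cocycle, the
correction terms vanish, because `x_i` divides the values of the cocycle on `e_J t^{(q)}` for
`i ∈ J`. The product formula therefore holds on the nose for cochains (`exists_isLift_coch`), and
graded commutativity follows from bilinearity and `sgn_swap` (`exists_isLift_comm`).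
-/

namespace SqfreeHH

/-! ### Signs of subsets -/

section Signs

variable {n : ℕ}

theorem sgnElt_mul_self (i : Fin n) (I : Finset (Fin n)) : sgnElt i I * sgnElt i I = 1 := by
  rw [sgnElt, ← mul_pow]; simp

theorem sgnElt_insert {i j : Fin n} {I : Finset (Fin n)} (hj : j ∉ I) :
    sgnElt i (insert j I) = (if j < i then -1 else 1) * sgnElt i I := by
  unfold sgnElt
  rw [Finset.filter_insert]
  split_ifs with h
  · rw [Finset.card_insert_of_notMem (by simp [hj]), pow_succ]; ring
  · simp

theorem sgnElt_erase {i j : Fin n} {I : Finset (Fin n)} (hj : j ∈ I) :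
    sgnElt i (I.erase j) = (if j < i then -1 else 1) * sgnElt i I := by
  have h := sgnElt_insert (i := i) (Finset.notMem_erase j I)
  rw [Finset.insert_erase hj] at h
  rw [h, ← mul_assoc]
  split_ifs <;> simp

theorem sgnElt_insert_self (i : Fin n) (I : Finset (Fin n)) :
    sgnElt i (insert i I) = sgnElt i I := by
  by_cases h : i ∈ I
  · rw [Finset.insert_eq_self.2 h]
  · simp [sgnElt_insert h]

theorem sgnElt_erase_self (i : Fin n) (I : Finset (Fin n)) :
    sgnElt i (I.erase i) = sgnElt i I := by
  by_cases h : i ∈ I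
  · simp [sgnElt_erase h]
  · rw [Finset.erase_eq_of_notMem h]

end Signs

/-- Families of coefficients indexed by all the symbols `e_I t^{(q)}`, in every degree at once.
Infinite families are allowed: no argument below needs finiteness. -/
abbrev Coeff (R : Type*) (n : ℕ) : Type _ := Finset (Fin n) × ℕ → R

/-! ### Contractions, multiplications and the Tate differential -/

section Operators

variable {R : Type*} [CommRing R] {n : ℕ}

/-- Contraction by `e_i`: `e_I t^{(q)} ↦ sgn(i, I) e_{I ∖ i} t^{(q)}` for `i ∈ I`, and `0`
otherwise. -/
def contr (i : Fin n) : Coeff R n →ₗ[R] Coeff R n where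
  toFun z b := if i ∈ b.1 then 0 else (sgnElt i b.1 : R) * z (insert i b.1, b.2)
  map_add' z w := by
    ext b; dsimp only [Pi.add_apply]; split_ifs <;> ring
  map_smul' r z := by
    ext b; simp only [Pi.smul_apply, smul_eq_mul, RingHom.id_apply]; split_ifs <;> ring

/-- Left multiplication by `e_i`: `e_I t^{(q)} ↦ sgn(i, I) e_{I ∪ i} t^{(q)}` for `i ∉ I`, and `0`
otherwise. -/
def wedge (i : Fin n) : Coeff R n →ₗ[R] Coeff R n where
  toFun z b := if i ∈ b.1 then (sgnElt i b.1 : R) * z (b.1.erase i, b.2) else 0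
  map_add' z w := by
    ext b; dsimp only [Pi.add_apply]; split_ifs <;> ring
  map_smul' r z := by
    ext b; simp only [Pi.smul_apply, smul_eq_mul, RingHom.id_apply]; split_ifs <;> ring

/-- `e_I t^{(q)} ↦ e_I t^{(q-1)}`, and `0` for `q = 0`. -/
def lower : Coeff R n →ₗ[R] Coeff R n where
  toFun z b := z (b.1, b.2 + 1)
  map_add' _ _ := rfl
  map_smul' _ _ := rfl

/-- `e_I t^{(q)} ↦ e_I t^{(q+1)}`. -/
def raise : Coeff R n →ₗ[R] Coeff R n where
  toFun z b := if b.2 = 0 then 0 else z (b.1, b.2 - 1)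
  map_add' z w := by
    ext b; dsimp only [Pi.add_apply]; split_ifs <;> ring
  map_smul' r z := by
    ext b; simp only [Pi.smul_apply, smul_eq_mul, RingHom.id_apply]; split_ifs <;> ring

theorem contr_apply (i : Fin n) (z : Coeff R n) (I : Finset (Fin n)) (q : ℕ) :
    contr i z (I, q) = if i ∈ I then 0 else (sgnElt i I : R) * z (insert i I, q) := rfl

theorem wedge_apply (i : Fin n) (z : Coeff R n) (I : Finset (Fin n)) (q : ℕ) :
    wedge i z (I, q) = if i ∈ I then (sgnElt i I : R) * z (I.erase i, q) else 0 := rfl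

theorem lower_apply (z : Coeff R n) (I : Finset (Fin n)) (q : ℕ) :
    lower z (I, q) = z (I, q + 1) := rfl

theorem raise_apply (z : Coeff R n) (I : Finset (Fin n)) (q : ℕ) :
    raise z (I, q) = if q = 0 then 0 else z (I, q - 1) := rfl

theorem contr_contr_self (i : Fin n) (z : Coeff R n) : contr i (contr i z) = 0 := by
  ext ⟨I, q⟩
  simp [contr_apply]

theorem wedge_wedge_self (i : Fin n) (z : Coeff R n) : wedge i (wedge i z) = 0 := by
  ext ⟨I, q⟩
  simp [wedge_apply]

theorem contr_contr (i j : Fin n) (z : Coeff R n) :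
    contr i (contr j z) = -contr j (contr i z) := by
  rcases eq_or_ne i j with rfl | hij
  · simp [contr_contr_self]
  ext ⟨I, q⟩
  simp only [contr_apply, Pi.neg_apply, Finset.mem_insert, hij, hij.symm, false_or]
  by_cases hi : i ∈ I
  · simp [hi]
  by_cases hj : j ∈ I
  · simp [hj]
  simp only [hi, hj, if_false, sgnElt_insert hi, sgnElt_insert hj, Finset.insert_comm i j]
  rcases lt_or_gt_of_ne hij with h | h
  · simp only [h, h.not_gt, if_true, if_false]; push_cast; ring
  · simp only [h, h.not_gt, if_true, if_false]; push_cast; ring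

theorem wedge_wedge (i j : Fin n) (z : Coeff R n) :
    wedge i (wedge j z) = -wedge j (wedge i z) := by
  rcases eq_or_ne i j with rfl | hij
  · simp [wedge_wedge_self]
  ext ⟨I, q⟩
  simp only [wedge_apply, Pi.neg_apply, Finset.mem_erase, ne_eq, hij, hij.symm, not_false_eq_true,
    true_and]
  by_cases hi : i ∈ I
  swap
  · simp [hi]
  by_cases hj : j ∈ I
  swap
  · simp [hj]
  simp only [hi, hj, if_true, sgnElt_erase hi, sgnElt_erase hj, Finset.erase_right_comm (a := i)]
  rcases lt_or_gt_of_ne hij with h | h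
  · simp only [h, h.not_gt, if_true, if_false]; push_cast; ring
  · simp only [h, h.not_gt, if_true, if_false]; push_cast; ring

theorem contr_wedge_self (i : Fin n) (z : Coeff R n) :
    contr i (wedge i z) + wedge i (contr i z) = z := by
  ext ⟨I, q⟩
  have h1 : (sgnElt i I : R) * sgnElt i I = 1 := by exact_mod_cast congrArg (Int.cast : ℤ → R) (sgnElt_mul_self i I)
  by_cases hi : i ∈ I
  · simp [contr_apply, wedge_apply, hi, sgnElt_erase_self, ← mul_assoc, h1]
  · simp [contr_apply, wedge_apply, hi, sgnElt_insert_self, ← mul_assoc, h1]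

theorem contr_wedge_of_ne {i j : Fin n} (hij : i ≠ j) (z : Coeff R n) :
    contr i (wedge j z) = -wedge j (contr i z) := by
  ext ⟨I, q⟩
  simp only [contr_apply, wedge_apply, Pi.neg_apply, Finset.mem_insert, Finset.mem_erase, ne_eq,
    hij, hij.symm, false_or, not_false_eq_true, true_and]
  by_cases hi : i ∈ I
  · simp [hi]
  by_cases hj : j ∈ I
  swap
  · simp [hj]
  simp only [hi, hj, if_true, if_false, sgnElt_erase hj, sgnElt_insert hi,
    Finset.erase_insert_of_ne hij]
  rcases lt_or_gt_of_ne hij with h | h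
  · simp only [h, h.not_gt, if_true, if_false]; push_cast; ring
  · simp only [h, h.not_gt, if_true, if_false]; push_cast; ring

theorem lower_contr (i : Fin n) (z : Coeff R n) : lower (contr i z) = contr i (lower z) := rfl

theorem lower_wedge (i : Fin n) (z : Coeff R n) : lower (wedge i z) = wedge i (lower z) := rfl

theorem raise_contr (i : Fin n) (z : Coeff R n) : raise (contr i z) = contr i (raise z) := by
  ext ⟨I, q⟩
  simp only [raise_apply, contr_apply]
  split_ifs <;> simp

theorem raise_wedge (i : Fin n) (z : Coeff R n) : raise (wedge i z) = wedge i (raise z) := by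
  ext ⟨I, q⟩
  simp only [raise_apply, wedge_apply]
  split_ifs <;> simp

theorem lower_raise (z : Coeff R n) : lower (raise z) = z := by
  ext ⟨I, q⟩
  simp [lower_apply, raise_apply]

/-- The Koszul differential `∑ a_i ι_i`. -/
def koszul (a : Fin n → R) : Coeff R n →ₗ[R] Coeff R n := ∑ i, a i • contr i

/-- Left multiplication by the element `∑ s_i e_i` of degree one. -/
def mulForm (s : Fin n → R) : Coeff R n →ₗ[R] Coeff R n := ∑ i, s i • wedge i

theorem koszul_apply (a : Fin n → R) (z : Coeff R n) : koszul a z = ∑ i, a i • contr i z := by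
  simp [koszul, LinearMap.sum_apply]

theorem mulForm_apply (s : Fin n → R) (z : Coeff R n) : mulForm s z = ∑ i, s i • wedge i z := by
  simp [mulForm, LinearMap.sum_apply]

theorem contr_koszul (a : Fin n → R) (j : Fin n) (z : Coeff R n) :
    contr j (koszul a z) = -koszul a (contr j z) := by
  simp only [koszul_apply, map_sum, map_smul, contr_contr j, smul_neg, Finset.sum_neg_distrib]

theorem wedge_mulForm (s : Fin n → R) (j : Fin n) (z : Coeff R n) :
    wedge j (mulForm s z) = -mulForm s (wedge j z) := by
  simp only [mulForm_apply, map_sum, map_smul, wedge_wedge j, smul_neg, Finset.sum_neg_distrib]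

theorem koszul_wedge (a : Fin n → R) (j : Fin n) (z : Coeff R n) :
    koszul a (wedge j z) = a j • z - wedge j (koszul a z) := by
  have h : ∀ i, a i • contr i (wedge j z) + a i • wedge j (contr i z) =
      if i = j then a j • z else 0 := by
    intro i
    rcases eq_or_ne i j with rfl | hij
    · rw [← smul_add, contr_wedge_self, if_pos rfl]
    · rw [contr_wedge_of_ne hij, if_neg hij, smul_neg, neg_add_cancel]
  have h2 := Finset.sum_congr (rfl : (Finset.univ : Finset (Fin n)) = _) (fun i _ => h i)
  rw [Finset.sum_add_distrib, Finset.sum_ite_eq' Finset.univ j, if_pos (Finset.mem_univ j)] at h2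
  rw [eq_sub_iff_add_eq, ← h2]
  simp only [koszul_apply, map_sum, map_smul]

theorem contr_mulForm (s : Fin n → R) (j : Fin n) (z : Coeff R n) :
    contr j (mulForm s z) = s j • z - mulForm s (contr j z) := by
  have h : ∀ i, s i • contr j (wedge i z) + s i • wedge i (contr j z) =
      if i = j then s j • z else 0 := by
    intro i
    rcases eq_or_ne i j with rfl | hij
    · rw [← smul_add, contr_wedge_self, if_pos rfl]
    · rw [contr_wedge_of_ne hij.symm, if_neg hij, smul_neg, neg_add_cancel]
  have h2 := Finset.sum_congr (rfl : (Finset.univ : Finset (Fin n)) = _) (fun i _ => h i)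
  rw [Finset.sum_add_distrib, Finset.sum_ite_eq' Finset.univ j, if_pos (Finset.mem_univ j)] at h2
  rw [eq_sub_iff_add_eq, ← h2]
  simp only [mulForm_apply, map_sum, map_smul]

theorem koszul_mulForm (a s : Fin n → R) (z : Coeff R n) :
    koszul a (mulForm s z) = (∑ i, a i * s i) • z - mulForm s (koszul a z) := by
  rw [mulForm_apply, map_sum, Finset.sum_smul, mulForm_apply, ← Finset.sum_sub_distrib]
  refine Finset.sum_congr rfl fun i _ => ?_
  rw [map_smul, koszul_wedge, smul_sub, smul_smul, mul_comm]

/-- A double sum over an antisymmetric array with zero diagonal vanishes. -/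
theorem sum_sum_eq_zero_of_antisymm {ι M : Type*} [Fintype ι] [AddCommGroup M]
    (B : ι → ι → M) (h : ∀ i j, B i j = -B j i) (h0 : ∀ i, B i i = 0) :
    ∑ i, ∑ j, B i j = 0 := by
  classical
  rw [← Finset.sum_product']
  refine Finset.sum_involution (fun p _ => p.swap) ?_ ?_ ?_ ?_
  · rintro ⟨i, j⟩ _
    simp [h i j]
  · rintro ⟨i, j⟩ _ hne heq
    obtain rfl : j = i := congrArg Prod.fst heq
    exact hne (h0 _)
  · intros; simp
  · intros; simp

theorem koszul_koszul (a : Fin n → R) (z : Coeff R n) : koszul a (koszul a z) = 0 := by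
  simp only [koszul_apply, map_sum, map_smul, Finset.smul_sum]
  refine sum_sum_eq_zero_of_antisymm _ (fun i j => ?_) (fun i => ?_)
  · rw [contr_contr, smul_neg, smul_neg, smul_comm]
  · rw [contr_contr_self, smul_zero, smul_zero]

theorem mulForm_mulForm (s : Fin n → R) (z : Coeff R n) : mulForm s (mulForm s z) = 0 := by
  simp only [mulForm_apply, map_sum, map_smul, Finset.smul_sum]
  refine sum_sum_eq_zero_of_antisymm _ (fun i j => ?_) (fun i => ?_)
  · rw [wedge_wedge, smul_neg, smul_neg, smul_comm]
  · rw [wedge_wedge_self, smul_zero, smul_zero]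

theorem lower_koszul (a : Fin n → R) (z : Coeff R n) :
    lower (koszul a z) = koszul a (lower z) := by
  simp only [koszul_apply, map_sum, map_smul, lower_contr]

theorem lower_mulForm (s : Fin n → R) (z : Coeff R n) :
    lower (mulForm s z) = mulForm s (lower z) := by
  simp only [mulForm_apply, map_sum, map_smul, lower_wedge]

theorem raise_koszul (a : Fin n → R) (z : Coeff R n) :
    raise (koszul a z) = koszul a (raise z) := by
  simp only [koszul_apply, map_sum, map_smul, raise_contr]

/-- The differential `∑ a_i ι_i + (∑ s_i e_i) T` where `T` lowers the divided power; it squares to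
`(∑ a_i s_i) T`. -/
def tate (a s : Fin n → R) : Coeff R n →ₗ[R] Coeff R n := koszul a + mulForm s ∘ₗ lower

theorem tate_apply (a s : Fin n → R) (z : Coeff R n) :
    tate a s z = koszul a z + mulForm s (lower z) := rfl

theorem lower_tate (a s : Fin n → R) (z : Coeff R n) :
    lower (tate a s z) = tate a s (lower z) := by
  simp only [tate_apply, map_add, lower_koszul, lower_mulForm]

theorem tate_tate (a s : Fin n → R) (z : Coeff R n) :
    tate a s (tate a s z) = (∑ i, a i * s i) • lower z := by
  simp only [tate_apply, map_add, koszul_koszul, lower_koszul, lower_mulForm, koszul_mulForm,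
    mulForm_mulForm]
  abel

theorem tate_contr (a s : Fin n → R) (i : Fin n) (z : Coeff R n) :
    tate a s (contr i z) = s i • lower z - contr i (tate a s z) := by
  simp only [tate_apply, map_add, contr_koszul, contr_mulForm, lower_contr]
  abel

theorem tate_wedge (a s : Fin n → R) (i : Fin n) (z : Coeff R n) :
    tate a s (wedge i z) = a i • z - wedge i (tate a s z) := by
  simp only [tate_apply, map_add, wedge_mulForm, koszul_wedge, lower_wedge]
  abel

end Operators

/-! ### Koszul exactness and reduction modulo a nonzerodivisor -/

section Exactness

variable {R : Type*} [CommRing R] {n : ℕ}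

/-- Exactness of the Koszul complex of a weakly regular sequence, by induction on the number `s` of
variables that occur: `z` is free of `e_j` for `j ≥ s` exactly when `ι_j z = 0` for these `j`. -/
theorem exists_koszul_eq (a : Fin n → R)
    (hreg : ∀ (s : Fin n) (c : R), a s * c ∈ Ideal.span (a '' {j | j < s}) →
      c ∈ Ideal.span (a '' {j | j < s})) (s : ℕ) (hs : s ≤ n) :
    ∀ z : Coeff R n, koszul a z = 0 → (∀ j : Fin n, s ≤ j.val → contr j z = 0) →
      (∀ q, z (∅, q) ∈ Ideal.span (a '' {j | j.val < s})) →
      ∃ y : Coeff R n, (∀ j : Fin n, s ≤ j.val → contr j y = 0) ∧ koszul a y = z := by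
  induction s with
  | zero =>
    intro z _ hz hc
    refine ⟨0, by simp, ?_⟩
    rw [map_zero]
    ext ⟨I, q⟩
    rcases I.eq_empty_or_nonempty with rfl | ⟨i, hi⟩
    · have h := hc q
      simp only [Nat.not_lt_zero, Set.ofPred_false, Set.image_empty, Ideal.span_empty,
        Ideal.mem_bot] at h
      exact h.symm
    · have h := congrFun (hz i (Nat.zero_le _)) (I.erase i, q)
      rw [contr_apply, if_neg (Finset.notMem_erase i I), Finset.insert_erase hi] at h
      have h1 : (sgnElt i (I.erase i) : R) * sgnElt i (I.erase i) = 1 := by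
        exact_mod_cast congrArg (Int.cast : ℤ → R) (sgnElt_mul_self i (I.erase i))
      have h2 := congrArg (fun r => (sgnElt i (I.erase i) : R) * r) h
      simpa [← mul_assoc, h1] using h2.symm
  | succ s ih =>
    intro z hz hsupp hc
    let t : Fin n := ⟨s, hs⟩
    have hset' : {j : Fin n | j.val < s + 1} = insert t {j | j.val < s} := by
      ext j; simp only [Set.mem_ofPred_eq, Set.mem_insert_iff, Fin.ext_iff, t]; omega
    -- the component `ι_t z` along `e_t` is a cycle, hence a boundary
    have hz1 : koszul a (contr t z) = 0 := by
      rw [← neg_eq_zero, ← contr_koszul, hz, map_zero]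
    have hmem : ∀ (w : Coeff R n), (∀ j : Fin n, s ≤ j.val → contr j w = 0) → ∀ q,
        koszul a w (∅, q) ∈ Ideal.span (a '' {j | j.val < s}) := by
      intro w hw q
      rw [koszul_apply, Finset.sum_apply]
      refine Ideal.sum_mem _ fun j _ => ?_
      by_cases hj : s ≤ j.val
      · simp [hw j hj]
      · exact Ideal.mul_mem_right _ _ (Ideal.subset_span ⟨j, not_le.1 hj, rfl⟩)
    have hsupp1 : ∀ j : Fin n, s ≤ j.val → contr j (contr t z) = 0 := by
      intro j hj
      rcases hj.eq_or_lt with h | h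
      · obtain rfl : t = j := Fin.ext h
        exact contr_contr_self _ _
      · rw [contr_contr, hsupp j h, map_zero, neg_zero]
    have hsupp0 : ∀ j : Fin n, s ≤ j.val → contr j (contr t (wedge t z)) = 0 := by
      intro j hj
      rcases hj.eq_or_lt with h | h
      · obtain rfl : t = j := Fin.ext h
        exact contr_contr_self _ _
      · have : j ≠ t := fun e => by simp [e, t] at h
        rw [contr_contr, contr_wedge_of_ne this, hsupp j h, map_zero, neg_zero, map_zero, neg_zero]
    have hz0 : koszul a (contr t (wedge t z)) = -(a t • contr t z) := by
      rw [← neg_eq_iff_eq_neg, ← contr_koszul, koszul_wedge, hz, map_zero, sub_zero, map_smul]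
    have hc1 : ∀ q, contr t z (∅, q) ∈ Ideal.span (a '' {j | j.val < s}) := by
      intro q
      refine hreg t _ ?_
      have h := hmem _ hsupp0 q
      rw [hz0] at h
      exact neg_mem_iff.1 h
    obtain ⟨y, hy, hyz⟩ := ih (by omega) _ hz1 hsupp1 hc1
    -- a multiple of `e_t` corrects the constant coefficients modulo `a_t`
    have hdec : ∀ q, ∃ v : R, z (∅, q) - a t * v ∈ Ideal.span (a '' {j | j.val < s}) := by
      intro q
      have h := hc q
      rw [hset', Set.image_insert_eq, Ideal.mem_span_insert] at h
      obtain ⟨v, w, hw, hvw⟩ := h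
      exact ⟨v, by rw [hvw]; ring_nf; simpa using hw⟩
    choose v hv using hdec
    let u : Coeff R n := fun b => if b.1 = ∅ then v b.2 + y (∅, b.2) else 0
    have hu : ∀ j, contr j u = 0 := by
      intro j
      ext ⟨I, q⟩
      simp [contr_apply, u, Finset.insert_ne_empty]
    have hku : koszul a u = 0 := by simp [koszul_apply, hu]
    obtain ⟨w, hw, hwz⟩ := ih (by omega) (contr t (wedge t z) + a t • y - a t • u) (by
        rw [map_sub, map_add, map_smul, map_smul, hku, hyz, hz0]; simp)
      (by
        intro j hj
        rw [map_sub, map_add, map_smul, map_smul, hu, hy j hj, hsupp0 j hj]; simp)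
      (by
        intro q
        have : (contr t (wedge t z) + a t • y - a t • u) (∅, q) = z (∅, q) - a t * v q := by
          have h := congrFun (contr_wedge_self t z) (∅, q)
          simp only [Pi.add_apply, wedge_apply, Finset.notMem_empty, if_false, add_zero] at h
          simp only [Pi.add_apply, Pi.sub_apply, Pi.smul_apply, smul_eq_mul, u, if_true, h]
          ring
        rw [this]
        exact hv q)
    refine ⟨w - wedge t y + wedge t u, ?_, ?_⟩
    · intro j hj
      have : j ≠ t := fun e => by simp [e, t] at hj
      rw [map_add, map_sub, contr_wedge_of_ne this, contr_wedge_of_ne this, hu, hy j (by omega),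
        hw j (by omega)]
      simp
    · rw [map_add, map_sub, koszul_wedge, koszul_wedge, hwz, hku, hyz]
      conv_rhs => rw [← contr_wedge_self t z]
      simp only [map_zero]
      abel

/-- Exactness of the Koszul complex of a weakly regular sequence. -/
theorem exists_koszul_eq_of_regular (a : Fin n → R)
    (hreg : ∀ (s : Fin n) (c : R), a s * c ∈ Ideal.span (a '' {j | j < s}) →
      c ∈ Ideal.span (a '' {j | j < s}))
    (z : Coeff R n) (hz : koszul a z = 0) (hc : ∀ q, z (∅, q) ∈ Ideal.span (Set.range a)) :
    ∃ y : Coeff R n, koszul a y = z := by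
  obtain ⟨y, -, hy⟩ := exists_koszul_eq a hreg n le_rfl z hz (fun j hj => absurd j.2 (by omega))
    (fun q => by
      have : {j : Fin n | j.val < n} = Set.univ := by ext j; simp
      rw [this, Set.image_univ]; exact hc q)
  exact ⟨y, hy⟩

/-- Lifting a cycle modulo `f = ∑ a_i s_i`. If `D = ∑ a_i ι_i + (∑ s_i e_i) T` and `D z` is
divisible by the nonzerodivisor `f`, then `z` is a boundary: writing `D z = f w`, the relation
`D² = f T` gives `T z = D w`, so that `z - D (S w)`, with `S` right inverse to `T`, is a Koszul
cycle without divided powers. -/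
theorem exists_tate_eq (a s : Fin n → R)
    (hreg : ∀ (s : Fin n) (c : R), a s * c ∈ Ideal.span (a '' {j | j < s}) →
      c ∈ Ideal.span (a '' {j | j < s}))
    (hf : ∀ c : R, (∑ i, a i * s i) * c = 0 → c = 0)
    (z w : Coeff R n) (hzw : tate a s z = (∑ i, a i * s i) • w)
    (hc : z (∅, 0) ∈ Ideal.span (Set.range a)) :
    ∃ y : Coeff R n, tate a s y = z := by
  have hTz : lower z = tate a s w := by
    have h := tate_tate a s z
    rw [hzw, map_smul] at h
    ext b
    have hb := congrFun h b
    simp only [Pi.smul_apply, smul_eq_mul] at hb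
    rw [← sub_eq_zero]
    refine hf _ ?_
    rw [mul_sub, hb, sub_self]
  set z' := z - tate a s (raise w) with hz'
  have hTz' : lower z' = 0 := by
    rw [hz', map_sub, lower_tate, lower_raise, hTz, sub_self]
  have hDz' : tate a s z' = 0 := by
    rw [hz', map_sub, tate_tate, lower_raise, hzw, sub_self]
  have hkz' : koszul a z' = 0 := by
    rw [tate_apply, hTz', map_zero, add_zero] at hDz'
    exact hDz'
  have hmem : ∀ y : Coeff R n, ∀ q, koszul a y (∅, q) ∈ Ideal.span (Set.range a) := by
    intro y q
    rw [koszul_apply, Finset.sum_apply]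
    exact Ideal.sum_mem _ fun j _ => Ideal.mul_mem_right _ _ (Ideal.subset_span ⟨j, rfl⟩)
  have hmul : ∀ y : Coeff R n, ∀ q, mulForm s y (∅, q) = 0 := by
    intro y q
    simp [mulForm_apply, wedge_apply, Finset.sum_apply]
  obtain ⟨y, hy⟩ := exists_koszul_eq_of_regular a hreg z' hkz' (by
    rintro (_ | q)
    · rw [hz', Pi.sub_apply, tate_apply, Pi.add_apply, hmul, add_zero]
      exact Ideal.sub_mem _ hc (hmem _ _)
    · have : z' (∅, q + 1) = 0 := congrFun hTz' (∅, q)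
      rw [this]
      exact Ideal.zero_mem _)
  -- only the part of `y` without divided powers matters
  let y0 : Coeff R n := y - raise (lower y)
  have hy0 : lower y0 = 0 := by simp only [y0, map_sub, lower_raise, sub_self]
  refine ⟨raise w + y0, ?_⟩
  have h1 : tate a s y0 = z' := by
    rw [tate_apply, hy0, map_zero, add_zero]
    simp only [y0, map_sub, ← raise_koszul, ← lower_koszul, hy, hTz', map_zero, sub_zero]
  rw [map_add, h1, hz']
  abel

end Exactness

/-! ### Telescoping sums of mixed products -/

section Telescoping

variable {R : Type*} [CommRing R] {n : ℕ}

/-- The mixed products `x_1 ⋯ x_{i-1} y_{i+1} ⋯ y_n`. -/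
def mixedProd (x y : Fin n → R) (i : Fin n) : R :=
  (∏ j ∈ Finset.univ.filter (fun j => j < i), x j) *
    ∏ j ∈ Finset.univ.filter (fun j => i < j), y j

theorem sum_sub_mul_mixedProd (x y : Fin n → R) :
    ∑ i, (y i - x i) * mixedProd x y i = ∏ i, y i - ∏ i, x i := by
  have h := Finset.prod_sub_ordered Finset.univ y (fun i => y i - x i)
  simp only [sub_sub_cancel] at h
  rw [h, sub_sub_cancel]
  exact Finset.sum_congr rfl fun i _ => by rw [mixedProd, mul_assoc]

/-- The telescoping sum stopped at the index `i`. -/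
theorem sum_le_sub_mul_mixedProd (x y : Fin n → R) (i : Fin n) :
    ∑ l ∈ Finset.univ.filter (fun l => l ≤ i), (y l - x l) * mixedProd x y l =
      ∏ l, y l - x i * mixedProd x y i := by
  have h := Finset.prod_sub_ordered (Finset.univ.filter (fun l => l ≤ i)) y (fun i => y i - x i)
  simp only [sub_sub_cancel] at h
  have hle : Finset.univ.filter (fun l : Fin n => l ≤ i) =
      insert i (Finset.univ.filter (fun l => l < i)) := by
    ext l; simp [le_iff_eq_or_lt]
  have hx : ∏ l ∈ Finset.univ.filter (fun l : Fin n => l ≤ i), x l =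
      x i * ∏ l ∈ Finset.univ.filter (fun l : Fin n => l < i), x l := by
    rw [hle, Finset.prod_insert (by simp)]
  have hy : (∏ l ∈ Finset.univ.filter (fun l : Fin n => l ≤ i), y l) *
      ∏ l ∈ Finset.univ.filter (fun l : Fin n => i < l), y l = ∏ l, y l := by
    rw [← Finset.prod_filter_mul_prod_filter_not Finset.univ (fun l => l ≤ i)]
    simp
  rw [mixedProd, ← mul_assoc, ← hx, h, sub_mul, hy, sub_sub_cancel, Finset.sum_mul]
  refine Finset.sum_congr rfl fun l hl => ?_
  have hl' : l ≤ i := by simpa using hl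
  rw [mixedProd, mul_assoc, mul_assoc]
  congr 2
  · refine Finset.prod_congr ?_ fun _ _ => rfl
    ext j
    simp only [Finset.mem_filter, Finset.mem_univ, true_and]
    exact ⟨fun h => ⟨(h.trans_le hl').le, h⟩, fun h => h.2⟩
  · rw [← Finset.prod_union]
    · refine Finset.prod_congr ?_ fun _ _ => rfl
      ext j
      simp only [Finset.mem_filter, Finset.mem_univ, true_and, Finset.mem_union]
      constructor
      · intro h
        rcases le_or_gt j i with h' | h'
        · exact Or.inl ⟨h', h⟩
        · exact Or.inr h'
      · rintro (h | h)
        · exact h.2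
        · exact hl'.trans_lt h
    · refine Finset.disjoint_left.2 fun j h h' => ?_
      simp only [Finset.mem_filter, Finset.mem_univ, true_and] at h h'
      exact absurd h' (not_lt.2 h.1)

end Telescoping

/-! ### The weakly regular sequence `X_i - x_i` -/

section PolynomialRing

variable {B : Type*} [CommRing B] {n : ℕ}

open MvPolynomial

theorem X_sub_C_mul_eq_zero (x : Fin n → B) (i : Fin n) {c : MvPolynomial (Fin n) B}
    (h : (X i - C (x i)) * c = 0) : c = 0 := by
  let τ : MvPolynomial (Fin n) B →ₐ[B] MvPolynomial (Fin n) B := aeval fun j => X j + C (x j)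
  let τ' : MvPolynomial (Fin n) B →ₐ[B] MvPolynomial (Fin n) B := aeval fun j => X j - C (x j)
  have hτ : τ'.comp τ = AlgHom.id B _ := by
    refine MvPolynomial.algHom_ext fun j => ?_
    simp only [AlgHom.comp_apply, τ, τ', aeval_X, map_add, AlgHom.id_apply]
    rw [← MvPolynomial.algebraMap_eq, AlgHom.commutes]
    ring
  have h1 : X i * τ c = 0 := by
    have := congrArg τ h
    simp only [map_mul, map_sub, map_zero, τ, aeval_X] at this
    rw [← MvPolynomial.algebraMap_eq, AlgHom.commutes, add_sub_cancel_right] at this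
    exact this
  have h2 : τ c = 0 := (isRegular_X (n := i)).left (by simpa using h1)
  have h3 := congrArg τ' h2
  rw [map_zero, ← AlgHom.comp_apply, hτ] at h3
  exact h3

theorem sub_mem_of_forall_X (I : Ideal (MvPolynomial (Fin n) B))
    (θ : MvPolynomial (Fin n) B →ₐ[B] MvPolynomial (Fin n) B)
    (h : ∀ i, X i - θ (X i) ∈ I) (c : MvPolynomial (Fin n) B) : c - θ c ∈ I := by
  rw [← Ideal.Quotient.eq]
  have : (Ideal.Quotient.mkₐ B I) = (Ideal.Quotient.mkₐ B I).comp θ :=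
    MvPolynomial.algHom_ext fun i => Ideal.Quotient.eq.2 (h i)
  exact DFunLike.congr_fun this c

/-- The elements `X_i - x_i` form a weakly regular sequence: modulo the first ones, `X_j` may be
replaced by `x_j`. -/
theorem X_sub_C_regular (x : Fin n → B) (s : Fin n) (c : MvPolynomial (Fin n) B)
    (h : (X s - C (x s)) * c ∈ Ideal.span ((fun i => X i - C (x i)) '' {j | j < s})) :
    c ∈ Ideal.span ((fun i => X i - C (x i)) '' {j | j < s}) := by
  set I := Ideal.span ((fun i => (X i - C (x i) : MvPolynomial (Fin n) B)) '' {j | j < s}) with hI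
  let θ : MvPolynomial (Fin n) B →ₐ[B] MvPolynomial (Fin n) B :=
    aeval fun j => if j < s then C (x j) else X j
  have hθC : ∀ b, θ (C b) = C b := fun b => by
    rw [← MvPolynomial.algebraMap_eq, AlgHom.commutes]
  have hker : I ≤ RingHom.ker θ := by
    rw [hI, Ideal.span_le]
    rintro _ ⟨j, hj, rfl⟩
    have hj' : j < s := hj
    simp only [SetLike.mem_coe, RingHom.mem_ker, map_sub, hθC]
    simp [θ, hj']
  have h1 : θ ((X s - C (x s)) * c) = 0 := hker h
  rw [map_mul, map_sub, hθC] at h1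
  have h2 : θ (X s) = X s := by simp [θ]
  rw [h2] at h1
  have h3 := X_sub_C_mul_eq_zero x s h1
  have h4 := sub_mem_of_forall_X I θ (fun i => ?_) c
  · simpa [h3] using h4
  · by_cases hi : i < s
    · simp only [θ, aeval_X, if_pos hi]
      exact Ideal.subset_span ⟨i, hi, rfl⟩
    · simp [θ, hi]

theorem mem_span_X_sub_C (x : Fin n → B) (c : MvPolynomial (Fin n) B) (h : eval x c = 0) :
    c ∈ Ideal.span (Set.range fun i => (X i - C (x i) : MvPolynomial (Fin n) B)) := by
  have h4 := sub_mem_of_forall_X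
    (Ideal.span (Set.range fun i => (X i - C (x i) : MvPolynomial (Fin n) B)))
    ((Algebra.ofId B _).comp (aeval x)) (fun i => ?_) c
  · have : ((Algebra.ofId B (MvPolynomial (Fin n) B)).comp (aeval x)) c = 0 := by
      rw [AlgHom.comp_apply, MvPolynomial.aeval_eq_eval, h, map_zero]
    simpa [this] using h4
  · simp only [AlgHom.comp_apply, aeval_X]
    exact Ideal.subset_span ⟨i, rfl⟩

end PolynomialRing

/-! ### Base change of the differential -/

section BaseChange

variable {R R' : Type*} [CommRing R] [CommRing R'] {n : ℕ}

theorem tate_map (π : R →+* R') (a s : Fin n → R) (z : Coeff R n) :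
    (fun b => π (tate a s z b)) =
      tate (fun i => π (a i)) (fun i => π (s i)) (fun b => π (z b)) := by
  ext ⟨I, q⟩
  simp only [tate_apply, koszul_apply, mulForm_apply, Pi.add_apply, Finset.sum_apply,
    Pi.smul_apply, smul_eq_mul, map_add, map_sum, map_mul, contr_apply, wedge_apply, lower_apply,
    apply_ite π, map_zero, map_intCast]

end BaseChange

/-! ### The enveloping algebra as a quotient of `A[X_1, …, X_n]` -/

section Enveloping

variable (k : Type*) [Field k] (n : ℕ)

open MvPolynomial

theorem tens_mul {k : Type*} [Field k] {n : ℕ} (a b c e : Alg k n) :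
    tens a b * tens c e = tens (a * c) (b * e) :=
  Algebra.TensorProduct.tmul_mul_tmul a c b e

/-- The inclusion of the left factor, `a ↦ a ⊗ 1`. -/
noncomputable def inclLeft : Alg k n →ₐ[k] Env k n :=
  (Algebra.TensorProduct.includeLeft : Alg k n →ₐ[k] Alg k n ⊗[k] Alg k n)

/-- The inclusion of the right factor, `a ↦ 1 ⊗ a`. -/
noncomputable def inclRight : Alg k n →ₐ[k] Env k n :=
  (Algebra.TensorProduct.includeRight : Alg k n →ₐ[k] Alg k n ⊗[k] Alg k n)

theorem inclLeft_apply (a : Alg k n) : inclLeft k n a = tens a 1 := rfl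

theorem inclRight_apply (a : Alg k n) : inclRight k n a = tens 1 a := rfl

theorem tens_eq (a b : Alg k n) : tens a b = inclLeft k n a * inclRight k n b := by
  rw [inclLeft_apply, inclRight_apply, tens_mul, one_mul, mul_one]

theorem prod_var : ∏ i, var k (n := n) i = 0 := by
  unfold var
  rw [← map_prod]
  exact Ideal.Quotient.eq_zero_iff_mem.2 (Ideal.subset_span rfl)

theorem proj_surjective : Function.Surjective (proj k n) := Ideal.Quotient.mk_surjective

theorem proj_eq_zero_iff (P : MvPolynomial (Fin n) k) : proj k n P = 0 ↔ (∏ i, X i) ∣ P :=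
  Ideal.Quotient.eq_zero_iff_mem.trans Ideal.mem_span_singleton

theorem delta_eq (i : Fin n) :
    delta k i = inclRight k n (var k i) - inclLeft k n (var k i) := rfl

theorem split_eq : split k = mixedProd (fun i => inclLeft k n (var k i))
    (fun i => inclRight k n (var k i)) := by
  ext i
  rw [split, tens_eq, map_prod, map_prod, mixedProd]

/-- The presentation `A[X_1, …, X_n] → A ⊗ A` of the enveloping algebra, `X_i ↦ 1 ⊗ x_i`. -/
noncomputable def envPres : MvPolynomial (Fin n) (Alg k n) →+* Env k n :=
  eval₂Hom (inclLeft k n).toRingHom fun i => inclRight k n (var k i)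

theorem envPres_C (a : Alg k n) : envPres k n (C a) = inclLeft k n a := eval₂Hom_C _ _ _

theorem envPres_X (i : Fin n) : envPres k n (X i) = inclRight k n (var k i) := eval₂Hom_X' _ _ _

theorem envPres_surjective : Function.Surjective (envPres k n) := by
  have hR : ∀ b, ∃ r, envPres k n r = inclRight k n b := by
    intro b
    obtain ⟨P, rfl⟩ := proj_surjective k n b
    refine ⟨MvPolynomial.map (algebraMap k (Alg k n)) P, ?_⟩
    have : (envPres k n).comp (MvPolynomial.map (algebraMap k (Alg k n))) =
        ((inclRight k n).comp (proj k n)).toRingHom := by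
      refine MvPolynomial.ringHom_ext (fun c => ?_) (fun i => ?_)
      · simp only [RingHom.comp_apply, MvPolynomial.map_C, envPres_C]
        rw [AlgHom.commutes, ← MvPolynomial.algebraMap_eq]
        exact (AlgHom.commutes ((inclRight k n).comp (proj k n)) c).symm
      · simp only [RingHom.comp_apply, MvPolynomial.map_X, envPres_X]
        rfl
    exact DFunLike.congr_fun this P
  intro e
  change Alg k n ⊗[k] Alg k n at e
  induction e with
  | zero => exact ⟨0, map_zero _⟩
  | tmul a b =>
    obtain ⟨r, hr⟩ := hR b
    refine ⟨C a * r, ?_⟩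
    rw [map_mul, hr, envPres_C]
    exact (tens_eq k n a b).symm
  | add e e' h h' =>
    obtain ⟨r, hr⟩ := h
    obtain ⟨r', hr'⟩ := h'
    exact ⟨r + r', by rw [map_add, hr, hr']; rfl⟩

/-- The kernel of `A[X] → A ⊗ A` is generated by `X_1 ⋯ X_n`: there is an inverse
`A ⊗ A → A[X] / (X_1 ⋯ X_n)`. -/
theorem prod_X_dvd_of_envPres_eq_zero (r : MvPolynomial (Fin n) (Alg k n))
    (h : envPres k n r = 0) : (∏ i, X i) ∣ r := by
  let Q := MvPolynomial (Fin n) (Alg k n) ⧸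
    Ideal.span {(∏ i, X i : MvPolynomial (Fin n) (Alg k n))}
  let mk : MvPolynomial (Fin n) (Alg k n) →+* Q := Ideal.Quotient.mk _
  let ρ₁ : Alg k n →ₐ[k] Q := IsScalarTower.toAlgHom k (Alg k n) Q
  let ρ₂ : Alg k n →ₐ[k] Q := Ideal.Quotient.liftₐ _
    (aeval (fun i => mk (X i)) : MvPolynomial (Fin n) k →ₐ[k] Q) (by
      intro P hP
      obtain ⟨P', rfl⟩ := Ideal.mem_span_singleton.1 hP
      rw [map_mul, map_prod]
      simp only [aeval_X]
      rw [← map_prod]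
      have : mk (∏ i, X i) = 0 := Ideal.Quotient.eq_zero_iff_mem.2 (Ideal.subset_span rfl)
      rw [this, zero_mul])
  let ρ : Alg k n ⊗[k] Alg k n →ₐ[k] Q :=
    Algebra.TensorProduct.lift ρ₁ ρ₂ fun _ _ => Commute.all _ _
  let ρ' : Env k n →+* Q := ρ.toRingHom
  have hρ : ρ'.comp (envPres k n) = mk := by
    refine MvPolynomial.ringHom_ext (fun a => ?_) (fun i => ?_)
    · rw [RingHom.comp_apply, envPres_C]
      change ρ (a ⊗ₜ 1) = _
      rw [Algebra.TensorProduct.lift_tmul, map_one, mul_one]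
      rfl
    · rw [RingHom.comp_apply, envPres_X]
      change ρ (1 ⊗ₜ var k i) = _
      rw [Algebra.TensorProduct.lift_tmul, map_one, one_mul]
      change aeval (fun i => mk (X i)) (X i : MvPolynomial (Fin n) k) = _
      rw [aeval_X]
  have h1 : mk r = 0 := by rw [← hρ, RingHom.comp_apply, h, map_zero]
  exact Ideal.mem_span_singleton.1 (Ideal.Quotient.eq_zero_iff_mem.1 h1)

theorem mulMap_inclLeft (a : Alg k n) : mulMap k n (inclLeft k n a) = a := by
  rw [inclLeft_apply, mulMap_tens, mul_one]

theorem mulMap_inclRight (a : Alg k n) : mulMap k n (inclRight k n a) = a := by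
  rw [inclRight_apply, mulMap_tens, one_mul]

theorem mulMap_envPres (r : MvPolynomial (Fin n) (Alg k n)) :
    mulMap k n (envPres k n r) = eval (var k) r := by
  have : (mulMap k n).toRingHom.comp (envPres k n) = eval (var k) := by
    refine MvPolynomial.ringHom_ext (fun a => ?_) (fun i => ?_)
    · rw [RingHom.comp_apply, envPres_C, eval_C]
      exact mulMap_inclLeft k n a
    · rw [RingHom.comp_apply, envPres_X, eval_X]
      exact mulMap_inclRight k n _
  exact DFunLike.congr_fun this r

/-- Every cycle of the total differential over `A ⊗ A` whose constant coefficient multiplies out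
to `0` is a boundary. -/
theorem exists_tate_delta_split_eq (z : Coeff (Env k n) n)
    (hz : tate (delta k) (split k) z = 0) (hc : mulMap k n (z (∅, 0)) = 0) :
    ∃ y : Coeff (Env k n) n, tate (delta k) (split k) y = z := by
  choose Z hZ using fun b => envPres_surjective k n (z b)
  have hZ' : (fun b => envPres k n (Z b)) = z := funext hZ
  let x : Fin n → MvPolynomial (Fin n) (Alg k n) := fun i => C (var k i)
  let a : Fin n → MvPolynomial (Fin n) (Alg k n) := fun i => X i - x i
  let s : Fin n → MvPolynomial (Fin n) (Alg k n) := mixedProd x X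
  have ha : (fun i => envPres k n (a i)) = delta k := by
    ext i
    simp only [a, x, map_sub, envPres_X, envPres_C, delta_eq]
  have hs : (fun i => envPres k n (s i)) = split k := by
    rw [split_eq]
    ext i
    simp only [s, x, mixedProd, map_mul, map_prod, envPres_X, envPres_C]
  have hf : ∑ i, a i * s i = ∏ i, X i := by
    simp only [a, s, sum_sub_mul_mixedProd]
    simp only [x]
    rw [← map_prod, prod_var, map_zero, sub_zero]
  have hdvd : ∀ b, ∃ w, tate a s Z b = (∏ i, X i) * w := by
    intro b
    refine prod_X_dvd_of_envPres_eq_zero k n _ ?_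
    have := congrFun (tate_map (envPres k n) a s Z) b
    rw [ha, hs, hZ', hz] at this
    exact this
  choose w hw using hdvd
  have hnzd : ∀ c : MvPolynomial (Fin n) (Alg k n), (∑ i, a i * s i) * c = 0 → c = 0 := by
    intro c h
    rw [hf] at h
    exact (IsRegular.prod (s := Finset.univ) fun i _ => isRegular_X (n := i)).left
      (by simpa using h)
  obtain ⟨y, hy⟩ := exists_tate_eq a s (X_sub_C_regular (var k)) hnzd Z w
    (by rw [hf]; exact funext hw)
    (mem_span_X_sub_C _ _ (by rw [← mulMap_envPres, hZ, hc]))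
  refine ⟨fun b => envPres k n (y b), ?_⟩
  rw [← ha, ← hs, ← tate_map, hy, hZ']

end Enveloping

/-! ### The differential on basis elements -/

section Total

variable {R : Type*} [CommRing R] {n : ℕ}

theorem contr_single (i : Fin n) (I : Finset (Fin n)) (q : ℕ) :
    contr i (Pi.single (I, q) 1 : Coeff R n) =
      if i ∈ I then (sgnElt i I : R) • Pi.single (I.erase i, q) 1 else 0 := by
  ext ⟨L, r⟩
  rw [contr_apply]
  by_cases hL : i ∈ L
  · rw [if_pos hL]
    split_ifs
    · have : L ≠ I.erase i := fun h => by simp [h] at hL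
      simp [this]
    · rfl
  · rw [if_neg hL]
    by_cases hI : i ∈ I
    · rw [if_pos hI]
      have : insert i L = I ↔ L = I.erase i :=
        ⟨fun h => by rw [← h, Finset.erase_insert hL], fun h => by rw [h, Finset.insert_erase hI]⟩
      by_cases h : L = I.erase i
      · subst h
        simp [Pi.single_apply, Finset.insert_erase hI, sgnElt_erase_self]
      · simp [this, h]
    · rw [if_neg hI]
      have : insert i L ≠ I := fun h => hI (h ▸ Finset.mem_insert_self i L)
      simp [this]

theorem wedge_single (i : Fin n) (I : Finset (Fin n)) (q : ℕ) :
    wedge i (Pi.single (I, q) 1 : Coeff R n) =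
      if i ∈ I then 0 else (sgnElt i I : R) • Pi.single (insert i I, q) 1 := by
  ext ⟨L, r⟩
  rw [wedge_apply]
  by_cases hL : i ∈ L
  · rw [if_pos hL]
    by_cases hI : i ∈ I
    · rw [if_pos hI]
      have : L.erase i ≠ I := fun h => Finset.notMem_erase i L (h ▸ hI)
      simp [this]
    · rw [if_neg hI]
      have : L.erase i = I ↔ L = insert i I :=
        ⟨fun h => by rw [← h, Finset.insert_erase hL], fun h => by rw [h, Finset.erase_insert hI]⟩
      by_cases h : L = insert i I
      · subst h
        simp [Pi.single_apply, Finset.erase_insert hI, sgnElt_insert_self]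
      · simp [this, h]
  · rw [if_neg hL]
    split_ifs
    · rfl
    · have : L ≠ insert i I := fun h => by simp [h] at hL
      simp [this]

theorem lower_single (I : Finset (Fin n)) (q : ℕ) :
    lower (Pi.single (I, q) 1 : Coeff R n) =
      if 1 ≤ q then Pi.single (I, q - 1) 1 else 0 := by
  ext ⟨L, r⟩
  rw [lower_apply]
  by_cases hq : 1 ≤ q
  · have : r + 1 = q ↔ r = q - 1 := by omega
    simp [hq, Pi.single_apply, this]
  · have : r + 1 ≠ q := by omega
    simp [hq, this]

/-- The differential lowers the degree `|I| + 2q` by one. -/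
theorem tate_apply_eq_zero (a s : Fin n → R) {m : ℕ} {z : Coeff R n}
    (hz : ∀ b : Finset (Fin n) × ℕ, b.1.card + 2 * b.2 = m + 1 → z b = 0)
    (b : Finset (Fin n) × ℕ) (hb : b.1.card + 2 * b.2 = m) : tate a s z b = 0 := by
  obtain ⟨I, q⟩ := b
  dsimp only at hb
  simp only [tate_apply, koszul_apply, mulForm_apply, Pi.add_apply, Finset.sum_apply,
    Pi.smul_apply, contr_apply, wedge_apply, lower_apply]
  have h1 : ∀ i, i ∉ I → z (insert i I, q) = 0 := fun i hi =>
    hz _ (by dsimp only; rw [Finset.card_insert_of_notMem hi]; omega)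
  have h2 : ∀ i, i ∈ I → z (I.erase i, q + 1) = 0 := fun i hi =>
    hz _ (by
      have := Finset.card_erase_add_one hi
      dsimp only; omega)
  rw [Finset.sum_eq_zero, Finset.sum_eq_zero, add_zero]
  · intro i _
    split_ifs with hi
    · rw [h2 i hi, mul_zero, smul_zero]
    · exact smul_zero _
  · intro i _
    split_ifs with hi
    · exact smul_zero _
    · rw [h1 i hi, mul_zero, smul_zero]

end Total

/-! ### Exactness of the resolution -/

section Resolution

variable (k : Type*) [Field k] (n : ℕ)

instance finite_gen (m : ℕ) : Finite (Gen n m) :=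
  Finite.of_injective
    (fun b : Gen n m => ((b.1.1, ⟨b.1.2, by have := b.2; omega⟩) : Finset (Fin n) × Fin (m + 1)))
    (fun b c h => Subtype.ext (Prod.ext (congrArg (fun p => Prod.fst p) h :)
      (congrArg (fun p => (Prod.snd p).val) h :)))

/-- Extension by zero of an element of `F_m` to all symbols. -/
noncomputable def extend (m : ℕ) : F k n m →ₗ[Env k n] Coeff (Env k n) n where
  toFun z b := if h : b.1.card + 2 * b.2 = m then z ⟨b, h⟩ else 0
  map_add' z w := by ext b; simp only [Pi.add_apply]; split_ifs <;> simp
  map_smul' r z := by ext b; simp only [Pi.smul_apply, RingHom.id_apply]; split_ifs <;> simp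

/-- The component in `F_m` of a family of coefficients. -/
noncomputable def restrict (m : ℕ) : Coeff (Env k n) n →ₗ[Env k n] F k n m :=
  (Finsupp.linearEquivFunOnFinite (Env k n) (Env k n) (Gen n m)).symm.toLinearMap ∘ₗ
    LinearMap.funLeft (Env k n) (Env k n) Subtype.val

variable {n}

theorem extend_apply_of_eq {m : ℕ} (z : F k n m) (b : Gen n m) : extend k n m z b.1 = z b :=
  dif_pos b.2

theorem extend_apply_of_ne {m : ℕ} (z : F k n m) (b : Finset (Fin n) × ℕ)
    (hb : b.1.card + 2 * b.2 ≠ m) : extend k n m z b = 0 := dif_neg hb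

theorem restrict_apply {m : ℕ} (z : Coeff (Env k n) n) (b : Gen n m) :
    restrict k n m z b = z b.1 := rfl

theorem restrict_extend {m : ℕ} (z : F k n m) : restrict k n m (extend k n m z) = z := by
  ext b
  rw [restrict_apply, extend_apply_of_eq]

theorem extend_single {m : ℕ} (b : Gen n m) :
    extend k n m (Finsupp.single b 1) = Pi.single b.1 1 := by
  ext c
  by_cases hc : c.1.card + 2 * c.2 = m
  · rw [extend_apply_of_eq k _ ⟨c, hc⟩, Finsupp.single_apply, Pi.single_apply]
    simp only [Subtype.ext_iff, eq_comm]
  · rw [extend_apply_of_ne k _ c hc, Pi.single_apply, if_neg]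
    rintro rfl
    exact hc b.2

theorem extend_gen {m : ℕ} {I : Finset (Fin n)} {q : ℕ} (h : I.card + 2 * q = m) :
    extend k n m (gen k m I q) = Pi.single (I, q) 1 := by
  rw [gen, dif_pos h, extend_single]

theorem extend_d {m : ℕ} (z : F k n (m + 1)) :
    extend k n m (d k n m z) = tate (delta k) (split k) (extend k n (m + 1) z) := by
  suffices extend k n m ∘ₗ d k n m = tate (delta k) (split k) ∘ₗ extend k n (m + 1) from
    DFunLike.congr_fun this z
  refine Finsupp.lhom_ext' fun b => LinearMap.ext_ring ?_
  obtain ⟨⟨I, q⟩, h⟩ := b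
  dsimp only at h
  simp only [LinearMap.comp_apply, Finsupp.lsingle_apply, extend_single, tate_apply, d,
    Finsupp.linearCombination_single, one_smul, map_add, koszul_apply]
  congr 1
  · rw [map_sum, ← Finset.sum_subset (Finset.subset_univ I)]
    · refine Finset.sum_congr rfl fun i hi => ?_
      have := Finset.card_erase_add_one hi
      rw [contr_single, if_pos hi, map_zsmul, map_smul, extend_gen k (by omega), smul_comm,
        Int.cast_smul_eq_zsmul]
    · intro i _ hi
      rw [contr_single, if_neg hi, smul_zero]
  · rw [lower_single]
    split_ifs with hq
    · rw [mulForm_apply, map_sum, ← Finset.sum_subset (Finset.subset_univ Iᶜ)]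
      · refine Finset.sum_congr rfl fun i hi => ?_
        have hi := Finset.mem_compl.1 hi
        have := Finset.card_insert_of_notMem hi
        rw [wedge_single, if_neg hi, map_zsmul, map_smul, extend_gen k (by omega), smul_comm,
          Int.cast_smul_eq_zsmul]
      · intro i _ hi
        rw [wedge_single, if_pos (by simpa using hi), smul_zero]
    · rw [map_zero, map_zero]

theorem d_restrict {m : ℕ} (z : Coeff (Env k n) n) :
    d k n m (restrict k n (m + 1) z) = restrict k n m (tate (delta k) (split k) z) := by
  rw [← restrict_extend k (d k n m _), extend_d, ← sub_eq_zero, ← map_sub, ← map_sub]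
  ext b
  rw [restrict_apply]
  refine tate_apply_eq_zero _ _ (m := m) (fun c hc => ?_) b.1 b.2
  rw [Pi.sub_apply, extend_apply_of_eq k _ ⟨c, hc⟩, restrict_apply, sub_self]

theorem sum_delta_mul_split : ∑ i, delta k i * split k (n := n) i = 0 := by
  simp only [split_eq, delta_eq, sum_sub_mul_mixedProd]
  rw [← map_prod, ← map_prod, prod_var, map_zero, map_zero, sub_zero]

theorem d_comp_d (m : ℕ) : d k n m ∘ₗ d k n (m + 1) = 0 := by
  ext1 b
  refine LinearMap.ext_ring ?_
  simp only [LinearMap.comp_apply]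
  rw [← restrict_extend k (d k n m _), extend_d, extend_d, tate_tate, sum_delta_mul_split,
    zero_smul, map_zero]
  rfl

theorem aug_apply (z : F k n 0) : aug k n z = mulMap k n (extend k n 0 z (∅, 0)) := by
  suffices aug k n z = mulMap k n (z ⟨(∅, 0), rfl⟩) by
    rw [this, ← extend_apply_of_eq k z ⟨(∅, 0), rfl⟩]
  let ev : F k n 0 →ₗ[Env k n] Alg k n :=
    { toFun := fun z => mulMap k n (z ⟨(∅, 0), rfl⟩)
      map_add' := fun z w => by rw [Finsupp.add_apply, map_add]
      map_smul' := fun r z => by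
        rw [Finsupp.smul_apply, smul_eq_mul, map_mul]; rfl }
  suffices aug k n = ev from DFunLike.congr_fun this z
  refine Finsupp.lhom_ext' fun b => LinearMap.ext_ring ?_
  have hb : b = ⟨(∅, 0), rfl⟩ := by
    obtain ⟨⟨I, q⟩, h⟩ := b
    dsimp only at h
    refine Subtype.ext (Prod.ext ?_ ?_)
    · exact Finset.card_eq_zero.1 (Nat.eq_zero_of_add_eq_zero_right h)
    · dsimp only; omega
  subst hb
  simp [aug, ev]

/-- Exactness of the resolution at `F_0`. -/
theorem exists_d_eq_of_aug_eq_zero (z : F k n 0) (hz : aug k n z = 0) :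
    ∃ y, d k n 0 y = z := by
  have h0 : tate (delta k) (split k) (extend k n 0 z) = 0 := by
    ext ⟨I, q⟩
    simp only [tate_apply, koszul_apply, mulForm_apply, Pi.add_apply, Finset.sum_apply,
      Pi.smul_apply, contr_apply, wedge_apply, lower_apply]
    have h1 : ∀ i, i ∉ I → extend k n 0 z (insert i I, q) = 0 := fun i hi =>
      extend_apply_of_ne k _ _ (by
        dsimp only; rw [Finset.card_insert_of_notMem hi]; omega)
    have h2 : ∀ i, extend k n 0 z (I.erase i, q + 1) = 0 := fun i =>
      extend_apply_of_ne k _ _ (by dsimp only; omega)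
    rw [Finset.sum_eq_zero, Finset.sum_eq_zero, add_zero]
    · rfl
    · intro i _
      rw [h2, mul_zero, ite_self, smul_zero]
    · intro i _
      split_ifs with hi
      · exact smul_zero _
      · rw [h1 i hi, mul_zero, smul_zero]
  obtain ⟨y, hy⟩ := exists_tate_delta_split_eq k n (extend k n 0 z) h0 (by rw [← aug_apply, hz])
  exact ⟨restrict k n 1 y, by rw [d_restrict, hy, restrict_extend]⟩

/-- Exactness of the resolution in positive degrees. -/
theorem exists_d_eq_of_d_eq_zero {m : ℕ} (z : F k n (m + 1)) (hz : d k n m z = 0) :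
    ∃ y, d k n (m + 1) y = z := by
  obtain ⟨y, hy⟩ := exists_tate_delta_split_eq k n (extend k n (m + 1) z)
    (by rw [← extend_d, hz, map_zero])
    (by rw [extend_apply_of_ne k _ _ (by simp), map_zero])
  exact ⟨restrict k n (m + 2) y, by rw [d_restrict, hy, restrict_extend]⟩

end Resolution

/-! ### Uniqueness of lifts up to homotopy -/

section Homotopy

variable {k : Type*} [Field k] {n : ℕ}

/-- Lifting of a map on a free module through `D`, when the basis elements lift. -/
theorem exists_comp_eq {S α M N : Type*} [CommRing S] [AddCommGroup M] [AddCommGroup N]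
    [Module S M] [Module S N] (D : M →ₗ[S] N) (P : (α →₀ S) →ₗ[S] N)
    (h : ∀ b, ∃ y, D y = P b) : ∃ P' : (α →₀ S) →ₗ[S] M, D ∘ₗ P' = P := by
  choose y hy using fun b => h (Finsupp.single b 1)
  refine ⟨Finsupp.linearCombination S y, Finsupp.lhom_ext' fun b => LinearMap.ext_ring ?_⟩
  simp [hy]

theorem aug_surjective : Function.Surjective (aug k n) := by
  intro a
  refine ⟨Finsupp.single ⟨(∅, 0), rfl⟩ (inclLeft k n a), ?_⟩
  rw [aug, Finsupp.linearCombination_single, inclLeft_apply, tens_smul, mul_one, mul_one]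

/-- A chain map over a coboundary carries cocycles to coboundaries: it differs from one factoring
through `d` by a null-homotopic chain map. -/
theorem comp_mem_coboundaries {i : ℕ} (χ : (m : ℕ) → F k n (i + m) →ₗ[Env k n] F k n m)
    (hχ : ∀ m, d k n m ∘ₗ χ (m + 1) = χ m ∘ₗ d k n (i + m))
    (h0 : aug k n ∘ₗ χ 0 ∈ coboundaries k n i) {j : ℕ} {g : Cochain k n j}
    (hg : g ∈ cocycles k n j) : g ∘ₗ χ j ∈ coboundaries k n (i + j) := by
  -- `c` lifts the coboundary `ε χ₀` and factors through `d` (it is zero in degree zero)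
  obtain ⟨c, hc, hcd, hcg⟩ : ∃ c : F k n i →ₗ[Env k n] F k n 0,
      aug k n ∘ₗ c = aug k n ∘ₗ χ 0 ∧ c ∘ₗ d k n i = 0 ∧
        ∀ g : Cochain k n 0, g ∘ₗ c ∈ coboundaries k n i := by
    cases i with
    | zero =>
      have h0' : aug k n ∘ₗ χ 0 = 0 := h0
      refine ⟨0, ?_, LinearMap.zero_comp _, fun g => ?_⟩
      · rw [h0', LinearMap.comp_zero]
      · rw [LinearMap.comp_zero]; exact Submodule.zero_mem _
    | succ i =>
      obtain ⟨u, hu⟩ := h0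
      have hu : u ∘ₗ d k n i = aug k n ∘ₗ χ 0 := hu
      obtain ⟨v, hv⟩ := exists_comp_eq (aug k n) u fun b => aug_surjective _
      refine ⟨v ∘ₗ d k n i, ?_, ?_, fun g => ⟨g ∘ₗ v, rfl⟩⟩
      · rw [← LinearMap.comp_assoc, hv, hu]
      · rw [LinearMap.comp_assoc, d_comp_d, LinearMap.comp_zero]
  have hstart : ∃ h : F k n (i + 0) →ₗ[Env k n] F k n 1, d k n 0 ∘ₗ h = χ 0 - c := by
    refine exists_comp_eq (d k n 0) (χ 0 - c) fun b => ?_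
    refine exists_d_eq_of_aug_eq_zero k _ ?_
    have := DFunLike.congr_fun hc b
    rw [LinearMap.sub_apply, map_sub]
    exact sub_eq_zero.2 this.symm
  have hstep : ∀ (m : ℕ) (h : F k n (i + m) →ₗ[Env k n] F k n (m + 1)),
      (d k n m ∘ₗ h) ∘ₗ d k n (i + m) = χ m ∘ₗ d k n (i + m) →
      ∃ h' : F k n (i + (m + 1)) →ₗ[Env k n] F k n (m + 1 + 1),
        d k n (m + 1) ∘ₗ h' = χ (m + 1) - h ∘ₗ d k n (i + m) := by
    intro m h hh
    refine exists_comp_eq (d k n (m + 1)) _ fun b => ?_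
    refine exists_d_eq_of_d_eq_zero k _ ?_
    have h1 := DFunLike.congr_fun (hχ m) b
    have h2 := DFunLike.congr_fun hh b
    rw [LinearMap.sub_apply, map_sub]
    exact sub_eq_zero.2 (h1.trans h2.symm)
  have hinv : ∀ (m : ℕ) (h : F k n (i + m) →ₗ[Env k n] F k n (m + 1))
      (h' : F k n (i + (m + 1)) →ₗ[Env k n] F k n (m + 1 + 1)),
      d k n (m + 1) ∘ₗ h' = χ (m + 1) - h ∘ₗ d k n (i + m) →
      (d k n (m + 1) ∘ₗ h') ∘ₗ d k n (i + (m + 1)) = χ (m + 1) ∘ₗ d k n (i + (m + 1)) := by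
    intro m h h' e
    rw [e]
    refine LinearMap.ext fun z => ?_
    have hz : d k n (i + m) (d k n (i + (m + 1)) z) = 0 :=
      DFunLike.congr_fun (d_comp_d k (n := n) (i + m)) z
    rw [LinearMap.comp_apply, LinearMap.sub_apply, LinearMap.comp_apply, hz, map_zero, sub_zero]
    rfl
  have hhom : ∀ m : ℕ, ∃ h : F k n (i + m) →ₗ[Env k n] F k n (m + 1),
      (d k n m ∘ₗ h) ∘ₗ d k n (i + m) = χ m ∘ₗ d k n (i + m) := by
    intro m
    induction m with
    | zero =>
      obtain ⟨h, hh⟩ := hstart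
      refine ⟨h, ?_⟩
      rw [hh]
      refine LinearMap.ext fun z => ?_
      have hz : c (d k n (i + 0) z) = 0 := DFunLike.congr_fun hcd z
      rw [LinearMap.comp_apply, LinearMap.sub_apply, hz, sub_zero]
      rfl
    | succ m ih =>
      obtain ⟨h, hh⟩ := ih
      obtain ⟨h', hh'⟩ := hstep m h hh
      exact ⟨h', hinv m h h' hh'⟩
  have hg' : g ∘ₗ d k n j = 0 := hg
  cases j with
  | zero =>
    obtain ⟨h, hh⟩ := hstart
    have : g ∘ₗ χ 0 = g ∘ₗ c := by
      rw [← sub_eq_zero, ← LinearMap.comp_sub, ← hh, ← LinearMap.comp_assoc, hg',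
        LinearMap.zero_comp]
    rw [this]
    exact hcg g
  | succ m =>
    obtain ⟨h, hh⟩ := hhom m
    obtain ⟨h', hh'⟩ := hstep m h hh
    refine ⟨g ∘ₗ h, ?_⟩
    change (g ∘ₗ h) ∘ₗ d k n (i + m) = _
    rw [LinearMap.comp_assoc, ← sub_eq_zero, ← neg_eq_zero, neg_sub, ← LinearMap.comp_sub, ← hh',
      ← LinearMap.comp_assoc, hg', LinearMap.zero_comp]

theorem cls_eq_cls_iff {m : ℕ} {f f' : Cochain k n m} (hf : f ∈ cocycles k n m)
    (hf' : f' ∈ cocycles k n m) : cls f hf = cls f' hf' ↔ f - f' ∈ coboundaries k n m :=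
  Submodule.Quotient.eq _

theorem comp_lift_mem_coboundaries {i j : ℕ} {f : Cochain k n i}
    {φ : (m : ℕ) → F k n (i + m) →ₗ[Env k n] F k n m} (hφ : IsLift f φ) {g : Cochain k n j}
    (hg : g ∈ coboundaries k n j) : g ∘ₗ φ j ∈ coboundaries k n (i + j) := by
  cases j with
  | zero =>
    obtain rfl : g = 0 := hg
    rw [LinearMap.zero_comp]
    exact Submodule.zero_mem _
  | succ j =>
    obtain ⟨u, rfl⟩ := hg
    refine ⟨u ∘ₗ φ j, ?_⟩
    change (u ∘ₗ φ j) ∘ₗ d k n (i + j) = (u ∘ₗ d k n j) ∘ₗ φ (j + 1)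
    rw [LinearMap.comp_assoc, LinearMap.comp_assoc, hφ.comm j]

/-- The cup product is single-valued. -/
theorem IsCup.unique {i j : ℕ} {a : HH k n i} {b : HH k n j} {c c' : HH k n (i + j)}
    (h : IsCup a b c) (h' : IsCup a b c') : c = c' := by
  obtain ⟨f, hf, g, hg, φ, hφ, rfl, rfl, rfl⟩ := h
  obtain ⟨f', hf', g', hg', φ', hφ', hff, hgg, rfl⟩ := h'
  rw [cls_eq_cls_iff] at hff hgg ⊢
  have e : g ∘ₗ φ j - g' ∘ₗ φ' j =
      g ∘ₗ (φ j - φ' j) - (g' - g) ∘ₗ φ' j := by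
    rw [LinearMap.comp_sub, LinearMap.sub_comp]; abel
  rw [e]
  refine Submodule.sub_mem _ ?_ (comp_lift_mem_coboundaries hφ' hgg)
  refine comp_mem_coboundaries (fun m => φ m - φ' m) (fun m => ?_) ?_ hg
  · rw [LinearMap.comp_sub, LinearMap.sub_comp, hφ.comm, hφ'.comm]
  · rw [LinearMap.comp_sub, hφ.aug_comp, hφ'.aug_comp, ← neg_sub]
    exact Submodule.neg_mem _ hff

end Homotopy

/-! ### Signs of pairs of subsets -/

section SignsOfSets

variable {n : ℕ}

theorem sgn_insert_left {s : Fin n} {I : Finset (Fin n)} (hs : s ∉ I) (J : Finset (Fin n)) :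
    sgn (insert s I) J = sgnElt s J * sgn I J := Finset.prod_insert hs

theorem sgn_insert_right_of_lt {s : Fin n} {I J : Finset (Fin n)} (hs : ∀ i ∈ I, i < s) :
    sgn I (insert s J) = sgn I J := by
  refine Finset.prod_congr rfl fun i hi => ?_
  by_cases hJ : s ∈ J
  · rw [Finset.insert_eq_self.2 hJ]
  · rw [sgnElt_insert hJ, if_neg (hs i hi).not_gt, one_mul]

theorem sgn_mul_self (I J : Finset (Fin n)) : sgn I J * sgn I J = 1 := by
  rw [sgn, ← Finset.prod_mul_distrib]
  exact Finset.prod_eq_one fun i _ => sgnElt_mul_self i J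

theorem sgnElt_eq_prod (i : Fin n) (J : Finset (Fin n)) :
    sgnElt i J = ∏ j ∈ J, if j < i then -1 else 1 := by
  rw [sgnElt, ← Finset.prod_filter, Finset.prod_const]

theorem sgn_mul_sgn_swap {I J : Finset (Fin n)} (h : Disjoint I J) :
    sgn I J * sgn J I = (-1) ^ (I.card * J.card) := by
  simp only [sgn, sgnElt_eq_prod]
  rw [Finset.prod_comm (s := J), ← Finset.prod_mul_distrib]
  have : ∀ i ∈ I, ((∏ j ∈ J, if j < i then (-1 : ℤ) else 1) * ∏ j ∈ J, if i < j then -1 else 1) =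
      (-1) ^ J.card := by
    intro i hi
    rw [← Finset.prod_mul_distrib, ← Finset.prod_const]
    refine Finset.prod_congr rfl fun j hj => ?_
    have hij : i ≠ j := fun e => Finset.disjoint_left.1 h hi (e ▸ hj)
    rcases lt_or_gt_of_ne hij with h | h <;> simp [h, h.not_gt]
  rw [Finset.prod_congr rfl this, Finset.prod_const, ← pow_mul, mul_comm]

theorem sgn_swap {I J : Finset (Fin n)} (h : Disjoint I J) {p q i j : ℕ}
    (hi : I.card + 2 * p = i) (hj : J.card + 2 * q = j) :
    sgn J I = (-1) ^ (i * j) * sgn I J := by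
  have e : ((-1 : ℤ)) ^ (i * j) = (-1) ^ (I.card * J.card) := by
    subst hi hj
    have : (I.card + 2 * p) * (J.card + 2 * q) =
        I.card * J.card + 2 * (p * J.card + I.card * q + 2 * p * q) := by ring
    rw [this, pow_add, pow_mul _ 2]
    simp
  rw [e, ← sgn_mul_sgn_swap h, mul_right_comm, sgn_mul_self, one_mul]

end SignsOfSets

/-! ### Cofactors in `A` -/

section Cofactors

variable (k : Type*) [Field k] {n : ℕ}

open MvPolynomial

/-- The image `x_1 ⋯ x_{i-1} x_{i+1} ⋯ x_n` in `A` of the coefficient `split k i`. -/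
noncomputable def cofactor (i : Fin n) : Alg k n := mulMap k n (split k i)

/-- The monomial `∏_{i ∈ I} x_i` in `A`. -/
noncomputable def varProd (I : Finset (Fin n)) : Alg k n := ∏ i ∈ I, var k i

theorem cofactor_eq (i : Fin n) : cofactor k i = ∏ j ∈ Finset.univ.erase i, var k j := by
  rw [cofactor, split, mulMap_tens, ← Finset.prod_union]
  · refine Finset.prod_congr ?_ fun _ _ => rfl
    ext j
    simp
  · refine Finset.disjoint_left.2 fun j h h' => ?_
    simp only [Finset.mem_filter, Finset.mem_univ, true_and] at h h'
    exact absurd h' h.not_gt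

theorem cofactor_mul_var (i : Fin n) : cofactor k i * var k i = 0 := by
  rw [cofactor_eq, Finset.prod_erase_mul _ _ (Finset.mem_univ i), prod_var]

theorem cofactor_mul_cofactor {i l : Fin n} (h : i ≠ l) : cofactor k i * cofactor k l = 0 := by
  rw [cofactor_eq k l, ← Finset.mul_prod_erase (Finset.univ.erase l) (var k) (a := i) (by simp [h]),
    ← mul_assoc, cofactor_mul_var, zero_mul]

theorem cofactor_mul_proj_eq_zero_iff (i : Fin n) (P : MvPolynomial (Fin n) k) :
    cofactor k i * proj k n P = 0 ↔ X i ∣ P := by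
  have h0 : (∏ j ∈ Finset.univ.erase i, X j : MvPolynomial (Fin n) k) ≠ 0 :=
    Finset.prod_ne_zero_iff.2 fun j _ => X_ne_zero j
  have h1 : cofactor k i * proj k n P = proj k n ((∏ j ∈ Finset.univ.erase i, X j) * P) := by
    rw [cofactor_eq, map_mul, map_prod]; rfl
  rw [h1, proj_eq_zero_iff, ← Finset.prod_erase_mul _ _ (Finset.mem_univ i)]
  exact mul_dvd_mul_iff_left h0

/-- The ideal generated by a cofactor contains no nonzero element killed by the cofactor. -/
theorem cofactor_mul_eq_zero_of_sq {i : Fin n} {a : Alg k n}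
    (h : cofactor k i * (cofactor k i * a) = 0) : cofactor k i * a = 0 := by
  obtain ⟨P, rfl⟩ := proj_surjective k n a
  have h1 : cofactor k i * proj k n P = proj k n ((∏ j ∈ Finset.univ.erase i, X j) * P) := by
    rw [cofactor_eq, map_mul, map_prod]; rfl
  rw [h1, cofactor_mul_proj_eq_zero_iff] at h
  rw [cofactor_mul_proj_eq_zero_iff]
  refine ((X_prime (i := i)).dvd_or_dvd h).resolve_left fun hd => ?_
  obtain ⟨j, hj, hij⟩ := (X_prime (i := i)).exists_mem_finset_dvd hd
  exact (Finset.ne_of_mem_erase hj).symm (X_dvd_X.1 hij)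

/-- An element of `A` is killed by the cofactors of all `x_i`, `i ∈ I`, only if it is divisible by
`∏_{i ∈ I} x_i`. -/
theorem exists_eq_varProd_mul {I : Finset (Fin n)} {a : Alg k n}
    (h : ∀ i ∈ I, cofactor k i * a = 0) : ∃ c, a = varProd k I * c := by
  obtain ⟨P, rfl⟩ := proj_surjective k n a
  have hd : (∏ i ∈ I, X i : MvPolynomial (Fin n) k) ∣ P := by
    refine Finset.prod_dvd_of_isRelPrime (fun i _ j _ hij => ?_) fun i hi =>
      (cofactor_mul_proj_eq_zero_iff k i P).1 (h i hi)
    exact (X_prime (i := i)).irreducible.isRelPrime_iff_not_dvd.2 fun hd => hij (X_dvd_X.1 hd)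
  obtain ⟨Q, rfl⟩ := hd
  exact ⟨proj k n Q, by rw [map_mul, map_prod]; rfl⟩

theorem cofactor_mul_varProd_mul {I : Finset (Fin n)} {i : Fin n} (hi : i ∈ I) (c : Alg k n) :
    cofactor k i * (varProd k I * c) = 0 := by
  rw [varProd, ← Finset.mul_prod_erase I (var k) hi, ← mul_assoc, ← mul_assoc, cofactor_mul_var,
    zero_mul, zero_mul]

theorem mulMap_delta (i : Fin n) : mulMap k n (delta k i) = 0 := by
  rw [delta_eq, map_sub, mulMap_inclLeft, mulMap_inclRight, sub_self]

end Cofactors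

/-! ### Chain-level derivations -/

section ChainMaps

variable (k : Type*) [Field k] {n : ℕ}

/-- The chain-level derivation `x_i ∂/∂x_i`: contraction by `e_i`, with coefficient `x_i ⊗ 1`,
corrected by lower terms so as to anticommute with the differential. -/
noncomputable def euler (i : Fin n) : Coeff (Env k n) n →ₗ[Env k n] Coeff (Env k n) n :=
  inclLeft k n (var k i) • contr i +
    ∑ l ∈ Finset.univ.filter (fun l => l ≤ i), split k l • (wedge l ∘ₗ lower)

theorem euler_apply (i : Fin n) (z : Coeff (Env k n) n) :
    euler k i z = inclLeft k n (var k i) • contr i z +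
      ∑ l ∈ Finset.univ.filter (fun l => l ≤ i), split k l • wedge l (lower z) := by
  simp [euler, LinearMap.sum_apply]

theorem tate_euler (i : Fin n) (z : Coeff (Env k n) n) :
    tate (delta k) (split k) (euler k i z) = -euler k i (tate (delta k) (split k) z) := by
  have h : inclLeft k n (var k i) * split k i +
      ∑ l ∈ Finset.univ.filter (fun l => l ≤ i), split k l * delta k l = 0 := by
    have := sum_le_sub_mul_mixedProd (fun i => inclLeft k n (var k i))
      (fun i => inclRight k n (var k i)) i
    rw [← map_prod, prod_var, map_zero, zero_sub, ← split_eq] at this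
    simp only [← delta_eq] at this
    rw [← neg_eq_iff_add_eq_zero, ← this]
    exact Finset.sum_congr rfl fun l _ => mul_comm _ _
  rw [euler_apply, euler_apply, map_add, map_smul, map_sum, tate_contr, smul_sub, smul_smul]
  have e : ∀ l, tate (delta k) (split k) (split k l • wedge l (lower z)) =
      (split k l * delta k l) • lower z -
        split k l • wedge l (lower (tate (delta k) (split k) z)) := by
    intro l
    rw [map_smul, tate_wedge, smul_sub, smul_smul, lower_tate]
  rw [Finset.sum_congr rfl fun l _ => e l, Finset.sum_sub_distrib, ← Finset.sum_smul]
  have h' := congrArg (fun r => r • lower z) h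
  simp only [add_smul, zero_smul] at h'
  rw [neg_add', ← zero_sub, ← h']
  abel

/-- In `A`, the correction terms of `euler k i` act by cofactors. -/
theorem mulMap_euler_apply (i : Fin n) (z : Coeff (Env k n) n) (J : Finset (Fin n)) (q : ℕ)
    {b : Alg k n} (hb : ∀ l ∈ J, cofactor k l * b = 0) :
    mulMap k n (euler k i z (J, q)) * b =
      if i ∈ J then 0
      else sgnElt i J • (mulMap k n (z (insert i J, q)) * (b * var k i)) := by
  have h2 : ∀ l, mulMap k n ((split k l • wedge l (lower z)) (J, q)) * b = 0 := by
    intro l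
    rw [Pi.smul_apply, smul_eq_mul, map_mul, wedge_apply]
    split_ifs with hl
    · rw [mul_right_comm]
      change cofactor k l * b * _ = 0
      rw [hb l hl, zero_mul]
    · rw [map_zero, mul_zero, zero_mul]
  rw [euler_apply, Pi.add_apply, Finset.sum_apply, map_add, map_sum, add_mul, Finset.sum_mul,
    Finset.sum_eq_zero fun l _ => h2 l, add_zero, Pi.smul_apply, smul_eq_mul, map_mul,
    mulMap_inclLeft, contr_apply]
  split_ifs with hi
  · rw [map_zero, mul_zero, zero_mul]
  · rw [map_mul, map_intCast, zsmul_eq_mul]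
    ring

/-- The composite of the derivations `euler k i`, `i ∈ I`, followed by evaluation at `e_J t^{(q)}`.
With the largest index outermost, the indices added to `J` before a given `i` exceed `i` and do not
change the sign `sgn(i, J)`, so that the signs multiply up to `sgn(I, J)`. -/
theorem exists_euler_comp (I : Finset (Fin n)) :
    ∃ Ψ : Coeff (Env k n) n →ₗ[Env k n] Coeff (Env k n) n,
      (∀ z, tate (delta k) (split k) (Ψ z) =
        (-1 : ℤ) ^ I.card • Ψ (tate (delta k) (split k) z)) ∧
      ∀ (z : Coeff (Env k n) n) (J : Finset (Fin n)) (q : ℕ) (b : Alg k n),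
        (∀ l ∈ J, cofactor k l * b = 0) →
        mulMap k n (Ψ z (J, q)) * b =
          if Disjoint I J then
            sgn I J • (mulMap k n (z (I ∪ J, q)) * (b * varProd k I))
          else 0 := by
  induction I using Finset.induction_on_max with
  | empty =>
    refine ⟨LinearMap.id, fun z => by simp, fun z J q b _ => ?_⟩
    simp [sgn, varProd]
  | insert s I hs ih =>
    obtain ⟨Ψ, hΨ, hev⟩ := ih
    have hsI : s ∉ I := fun h => lt_irrefl _ (hs s h)
    refine ⟨euler k s ∘ₗ Ψ, fun z => ?_, fun z J q b hb => ?_⟩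
    · rw [LinearMap.comp_apply, LinearMap.comp_apply, tate_euler, hΨ, map_zsmul,
        Finset.card_insert_of_notMem hsI, pow_succ, mul_neg_one, neg_smul]
    · rw [LinearMap.comp_apply, mulMap_euler_apply k s _ J q hb]
      by_cases hsJ : s ∈ J
      · rw [if_pos hsJ, if_neg]
        exact fun h => Finset.disjoint_left.1 h (Finset.mem_insert_self s I) hsJ
      · rw [if_neg hsJ, hev z (insert s J) q (b * var k s)]
        · simp only [Finset.disjoint_insert_left, Finset.disjoint_insert_right, hsJ, hsI,
            not_false_eq_true, true_and]
          split_ifs with hd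
          · rw [smul_smul, sgn_insert_left hsI, sgn_insert_right_of_lt hs, varProd, varProd,
              Finset.prod_insert hsI, Finset.union_insert, Finset.insert_union, mul_assoc b]
          · rw [smul_zero]
        · intro l hl
          rcases Finset.mem_insert.1 hl with rfl | hl
          · rw [mul_left_comm, cofactor_mul_var, mul_zero]
          · rw [← mul_assoc, hb l hl, zero_mul]

end ChainMaps

/-! ### Cocycles and their explicit lifts -/

section Cochains

variable (k : Type*) [Field k] {n : ℕ}

/-- The cochain in degree `m` that sends `e_I t^{(q)}` to `a` and all other basis elements to `0`
(it is `0` if the degree of `e_I t^{(q)}` is not `m`). -/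
noncomputable def coch (m : ℕ) (I : Finset (Fin n)) (q : ℕ) (a : Alg k n) : Cochain k n m where
  toFun z := mulMap k n (extend k n m z (I, q)) * a
  map_add' z w := by rw [map_add, Pi.add_apply, map_add, add_mul]
  map_smul' r z := by
    rw [map_smul, Pi.smul_apply, smul_eq_mul, map_mul, mul_assoc]
    rfl

theorem coch_apply (m : ℕ) (I : Finset (Fin n)) (q : ℕ) (a : Alg k n) (z : F k n m) :
    coch k m I q a z = mulMap k n (extend k n m z (I, q)) * a := rfl

theorem coch_restrict {m : ℕ} {I : Finset (Fin n)} {q : ℕ} (h : I.card + 2 * q = m) (a : Alg k n)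
    (w : Coeff (Env k n) n) :
    coch k m I q a (restrict k n m w) = mulMap k n (w (I, q)) * a := by
  rw [coch_apply, extend_apply_of_eq k _ ⟨(I, q), h⟩, restrict_apply]

theorem std_eq_coch (m : ℕ) (I : Finset (Fin n)) (q : ℕ) (α : Fin n →₀ ℕ) :
    std k m I q α = coch k m I q (mon k α) := by
  refine Finsupp.lhom_ext' fun b => LinearMap.ext_ring ?_
  simp only [LinearMap.comp_apply, Finsupp.lsingle_apply, std, Finsupp.linearCombination_single,
    one_smul, coch_apply, extend_single, Pi.single_apply]
  by_cases h : b.1 = (I, q)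
  · simp [h]
  · simp [h, Ne.symm h]

theorem env_smul_def (r : Env k n) (a : Alg k n) : r • a = mulMap k n r * a := rfl

theorem coch_mul (m : ℕ) (I : Finset (Fin n)) (q : ℕ) (a c : Alg k n) :
    coch k m I q (a * c) = inclLeft k n c • coch k m I q a := by
  ext1 b
  refine LinearMap.ext_ring ?_
  simp only [LinearMap.comp_apply, LinearMap.smul_apply, coch_apply, env_smul_def, mulMap_inclLeft]
  ring

theorem coch_mem_cocycles (m : ℕ) (I : Finset (Fin n)) (q : ℕ) {a : Alg k n}
    (ha : ∀ i ∈ I, cofactor k i * a = 0) : coch k m I q a ∈ cocycles k n m := by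
  change coch k m I q a ∘ₗ d k n m = 0
  refine LinearMap.ext fun z => ?_
  rw [LinearMap.comp_apply, coch_apply, extend_d, tate_apply, koszul_apply, mulForm_apply,
    Pi.add_apply, Finset.sum_apply, Finset.sum_apply, map_add, map_sum, map_sum]
  rw [Finset.sum_eq_zero, zero_add, Finset.sum_mul, Finset.sum_eq_zero, LinearMap.zero_apply]
  · intro i _
    rw [Pi.smul_apply, smul_eq_mul, map_mul, wedge_apply]
    split_ifs with hi
    · rw [mul_right_comm]
      change cofactor k i * a * _ = 0
      rw [ha i hi, zero_mul]
    · rw [map_zero, mul_zero, zero_mul]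
  · intro i _
    rw [Pi.smul_apply, smul_eq_mul, map_mul, mulMap_delta, zero_mul]

/-- The values of a cocycle on `e_I t^{(q)}` are killed by the cofactors of all `x_i`, `i ∈ I`,
since the ideals generated by the different cofactors are independent. -/
theorem cofactor_mul_apply_eq_zero {m : ℕ} {f : Cochain k n m} (hf : f ∈ cocycles k n m)
    {I : Finset (Fin n)} {q : ℕ} (h : I.card + 2 * q = m) {i : Fin n} (hi : i ∈ I) :
    cofactor k i * f (gen k m I q) = 0 := by
  have hf' : f ∘ₗ d k n m = 0 := hf
  have hcard := Finset.card_erase_add_one hi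
  have h1 := DFunLike.congr_fun hf'
    (Finsupp.single (⟨(I.erase i, q + 1), by dsimp only; omega⟩ : Gen n (m + 1)) 1)
  rw [LinearMap.comp_apply, d, Finsupp.linearCombination_single, one_smul, map_add,
    LinearMap.zero_apply] at h1
  dsimp only at h1
  rw [if_pos (Nat.le_add_left 1 q), map_sum, map_sum, Finset.sum_eq_zero, zero_add] at h1
  swap
  · intro l _
    rw [map_zsmul, map_smul, env_smul_def, mulMap_delta, zero_mul, smul_zero]
  -- multiplying by `cofactor k i` kills every term except that of `l = i`
  apply cofactor_mul_eq_zero_of_sq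
  have h2 := congrArg (fun a => sgnElt i (I.erase i) • (cofactor k i * a)) h1
  rw [Finset.mul_sum, Finset.sum_eq_single i] at h2
  · rw [map_zsmul, map_smul, env_smul_def, mul_smul_comm, smul_smul, sgnElt_mul_self, one_smul,
      Finset.insert_erase hi, Nat.add_sub_cancel, mul_zero, smul_zero] at h2
    exact h2
  · intro l _ hl
    rw [map_zsmul, map_smul, env_smul_def, mul_smul_comm, ← mul_assoc]
    change _ • (cofactor k i * cofactor k l * _) = 0
    rw [cofactor_mul_cofactor k hl.symm, zero_mul, smul_zero]
  · intro h
    simp at h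

/-- Every cocycle is a combination of the cocycles `∏_{i ∈ I} x_i` on `e_I t^{(q)}`. -/
theorem exists_eq_sum_coch [∀ m, Fintype (Gen n m)] {m : ℕ} {f : Cochain k n m}
    (hf : f ∈ cocycles k n m) :
    ∃ c : Gen n m → Env k n, f = ∑ b, c b • coch k m b.1.1 b.1.2 (varProd k b.1.1) := by
  have h : ∀ b : Gen n m, ∃ c, f (Finsupp.single b 1) = varProd k b.1.1 * c := by
    intro b
    refine exists_eq_varProd_mul k fun i hi => ?_
    have := cofactor_mul_apply_eq_zero k hf b.2 hi
    rwa [gen, dif_pos b.2] at this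
  choose c hc using h
  refine ⟨fun b => inclLeft k n (c b), ?_⟩
  refine Finsupp.lhom_ext' fun b => LinearMap.ext_ring ?_
  simp only [LinearMap.comp_apply, Finsupp.lsingle_apply, LinearMap.sum_apply,
    ← coch_mul, ← hc, coch_apply, extend_single]
  rw [Finset.sum_eq_single b]
  · rw [Pi.single_eq_same, map_one, one_mul]
  · intro b' _ hb'
    rw [Pi.single_eq_of_ne (fun e => hb' (Subtype.ext e)), map_zero, zero_mul]
  · intro h
    exact absurd (Finset.mem_univ b) h

theorem lower_iterate_apply (p : ℕ) (z : Coeff (Env k n) n) (I : Finset (Fin n)) (q : ℕ) :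
    (lower ^ p) z (I, q) = z (I, q + p) := by
  induction p generalizing z with
  | zero => rfl
  | succ p ih =>
    rw [pow_succ, Module.End.mul_apply, ih, lower_apply]
    rfl

theorem lower_iterate_tate (p : ℕ) (a s : Fin n → Env k n) (z : Coeff (Env k n) n) :
    (lower ^ p) (tate a s z) = tate a s ((lower ^ p) z) := by
  induction p generalizing z with
  | zero => rfl
  | succ p ih => rw [pow_succ, Module.End.mul_apply, lower_tate, ih, Module.End.mul_apply]

/-- The cocycle `∏_{i ∈ I} x_i` on `e_I t^{(p)}` has an explicit lift, for which the product with
standard cocycles can be read off. -/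
theorem exists_isLift_coch {I : Finset (Fin n)} {p i : ℕ} (h : I.card + 2 * p = i) :
    ∃ φ : (m : ℕ) → F k n (i + m) →ₗ[Env k n] F k n m,
      IsLift (coch k i I p (varProd k I)) φ ∧
      ∀ (J : Finset (Fin n)) (q j : ℕ) (b : Alg k n), J.card + 2 * q = j →
        (∀ l ∈ J, cofactor k l * b = 0) → ∀ z : F k n (i + j),
        coch k j J q b (φ j z) =
          if Disjoint I J then
            sgn J I • (mulMap k n (extend k n (i + j) z (I ∪ J, p + q)) * (b * varProd k I))
          else 0 := by
  obtain ⟨Ψ, hΨ, hev⟩ := exists_euler_comp k I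
  let φ : (m : ℕ) → F k n (i + m) →ₗ[Env k n] F k n m := fun m =>
    -- the sign turns a map (anti)commuting with `d` into one commuting with `d`
    (-1 : ℤ) ^ (i * m) • (restrict k n m ∘ₗ Ψ ∘ₗ (lower ^ p) ∘ₗ extend k n (i + m))
  have hφ : ∀ m z, φ m z = (-1 : ℤ) ^ (i * m) •
      restrict k n m (Ψ ((lower ^ p) (extend k n (i + m) z))) := fun m z => rfl
  have hprod : ∀ (J : Finset (Fin n)) (q j : ℕ) (b : Alg k n), J.card + 2 * q = j →
      (∀ l ∈ J, cofactor k l * b = 0) → ∀ z : F k n (i + j),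
      coch k j J q b (φ j z) =
        if Disjoint I J then
          sgn J I • (mulMap k n (extend k n (i + j) z (I ∪ J, p + q)) * (b * varProd k I))
        else 0 := by
    intro J q j b hj hb z
    rw [hφ, map_zsmul, coch_restrict k hj, hev _ J q b hb]
    split_ifs with hd
    · rw [smul_smul, ← sgn_swap hd h hj, lower_iterate_apply, add_comm q p]
    · rw [smul_zero]
  refine ⟨φ, ⟨?_, fun m => ?_⟩, hprod⟩
  · refine LinearMap.ext fun z => ?_
    have h0 := hprod ∅ 0 0 1 rfl (by simp) z
    rw [coch_apply, mul_one, ← aug_apply, if_pos (Finset.disjoint_empty_right I),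
      Finset.union_empty, one_mul, sgn, Finset.prod_empty, one_smul] at h0
    exact h0
  · refine LinearMap.ext fun z => ?_
    rw [LinearMap.comp_apply, LinearMap.comp_apply, hφ, hφ, map_zsmul, d_restrict, hΨ, map_zsmul,
      smul_smul, extend_d, lower_iterate_tate]
    congr 1
    have : i * (m + 1) + I.card = i * m + 2 * (I.card + p) := by rw [← h]; ring
    rw [← pow_add, this, pow_add, pow_mul _ 2]
    simp

theorem IsLift.smul {k : Type*} [Field k] {n i : ℕ} {f : Cochain k n i}
    {φ : (m : ℕ) → F k n (i + m) →ₗ[Env k n] F k n m} (hφ : IsLift f φ) (r : Env k n) :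
    IsLift (r • f) fun m => r • φ m where
  aug_comp := by rw [LinearMap.comp_smul, hφ.aug_comp]
  comm m := by rw [LinearMap.comp_smul, LinearMap.smul_comp, hφ.comm]

theorem IsLift.sum {k : Type*} [Field k] {n i : ℕ} {ι : Type*} (s : Finset ι)
    {f : ι → Cochain k n i}
    {φ : ι → (m : ℕ) → F k n (i + m) →ₗ[Env k n] F k n m} (hφ : ∀ b, IsLift (f b) (φ b)) :
    IsLift (∑ b ∈ s, f b) fun m => ∑ b ∈ s, φ b m where
  aug_comp := by
    refine LinearMap.ext fun z => ?_
    simp only [LinearMap.comp_apply, LinearMap.sum_apply, map_sum, ← (hφ _).aug_comp]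
  comm m := by
    refine LinearMap.ext fun z => ?_
    simp only [LinearMap.comp_apply, LinearMap.sum_apply, map_sum]
    exact Finset.sum_congr rfl fun b _ => DFunLike.congr_fun ((hφ b).comm m) z

end Cochains

/-! ### Cup products -/

section Products

variable {k : Type*} [Field k] {n : ℕ}

/-- Two cocycles have lifts for which the products in both orders agree up to the sign of graded
commutativity, already at the level of cochains. -/
theorem exists_isLift_comm {i j : ℕ} {f : Cochain k n i} (hf : f ∈ cocycles k n i)
    {g : Cochain k n j} (hg : g ∈ cocycles k n j) :
    ∃ (φ : (m : ℕ) → F k n (i + m) →ₗ[Env k n] F k n m)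
      (ψ : (m : ℕ) → F k n (j + m) →ₗ[Env k n] F k n m),
      IsLift f φ ∧ IsLift g ψ ∧ ∀ (z : F k n (i + j)) (z' : F k n (j + i)),
        extend k n (i + j) z = extend k n (j + i) z' →
        g (φ j z) = (-1 : ℤ) ^ (i * j) • f (ψ i z') := by
  classical
  have hfin : ∀ m, Fintype (Gen n m) := fun m => Fintype.ofFinite _
  obtain ⟨c, rfl⟩ := exists_eq_sum_coch k hf
  obtain ⟨e, rfl⟩ := exists_eq_sum_coch k hg
  choose φ hφ hφ' using fun b : Gen n i => exists_isLift_coch k b.2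
  choose ψ hψ hψ' using fun b : Gen n j => exists_isLift_coch k b.2
  refine ⟨_, _, IsLift.sum _ fun b => (hφ b).smul (c b), IsLift.sum _ fun b => (hψ b).smul (e b),
    fun z z' hz => ?_⟩
  simp only [LinearMap.sum_apply, LinearMap.smul_apply, map_sum, map_smul, Finset.smul_sum]
  rw [Finset.sum_comm]
  refine Finset.sum_congr rfl fun b' _ => Finset.sum_congr rfl fun b _ => ?_
  have hZ : ∀ I : Finset (Fin n), ∀ l ∈ I, cofactor k l * varProd k I = 0 := fun I l hl => by
    simpa using cofactor_mul_varProd_mul k hl 1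
  rw [hφ' b _ _ _ _ b'.2 (hZ _), hψ' b' _ _ _ _ b.2 (hZ _), hz]
  by_cases hd : Disjoint b.1.1 b'.1.1
  · rw [if_pos hd, if_pos hd.symm, sgn_swap hd b.2 b'.2, Finset.union_comm b.1.1,
      add_comm b.1.2, mul_comm (varProd k b.1.1)]
    rw [smul_comm (c b), mul_smul, smul_comm (_ : ℤ) (e b'), smul_comm (_ : ℤ) (c b)]
  · rw [if_neg hd, if_neg (fun h => hd h.symm)]
    simp only [smul_zero]

/-- Cochains of equal degrees that agree on elements with the same coefficients have classes
corresponding under the transport of degrees. -/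
theorem cast_cls {m m' : ℕ} (h : m = m') {f : Cochain k n m} (hf : f ∈ cocycles k n m)
    {f' : Cochain k n m'} (hf' : f' ∈ cocycles k n m')
    (hff : ∀ z z', extend k n m z = extend k n m' z' → f z = f' z') :
    HH.cast h (cls f hf) = cls f' hf' := by
  subst h
  obtain rfl : f = f' := LinearMap.ext fun z => hff z z rfl
  rfl

theorem zsmul_cls {m : ℕ} (r : ℤ) {f : Cochain k n m} (hf : f ∈ cocycles k n m)
    (hf' : r • f ∈ cocycles k n m) : r • cls f hf = cls (r • f) hf' := rfl

theorem cls_congr {m : ℕ} {f f' : Cochain k n m} (h : f = f') (hf : f ∈ cocycles k n m)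
    (hf' : f' ∈ cocycles k n m) : cls f hf = cls f' hf' := by
  subst h; rfl

theorem coch_zsmul (r : ℤ) (m : ℕ) (I : Finset (Fin n)) (q : ℕ) (a : Alg k n) (z : F k n m) :
    (r • coch k m I q a) z = r • (mulMap k n (extend k n m z (I, q)) * a) := rfl

theorem mon_add (α β : Fin n →₀ ℕ) : mon k (α + β) = mon k α * mon k β := by
  rw [mon, mon, mon, ← map_mul, MvPolynomial.monomial_mul, one_mul]

theorem apply_gen_std {m : ℕ} {I : Finset (Fin n)} {q : ℕ} (h : I.card + 2 * q = m)
    (α : Fin n →₀ ℕ) : std k m I q α (gen k m I q) = mon k α := by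
  rw [std_eq_coch, coch_apply, extend_gen k h, Pi.single_eq_same, map_one, one_mul]

/-- The product of standard cocycles. -/
theorem isCup_std {I J : Finset (Fin n)} {p q i j : ℕ} {α β : Fin n →₀ ℕ}
    (hi : I.card + 2 * p = i) (hj : J.card + 2 * q = j)
    (hf : std k i I p α ∈ cocycles k n i) (hg : std k j J q β ∈ cocycles k n j) :
    (Disjoint I J →
      ∃ hfg : std k (i + j) (I ∪ J) (p + q) (α + β) ∈ cocycles k n (i + j),
        IsCup (cls _ hf) (cls _ hg) (sgn J I • cls _ hfg)) ∧
    (¬Disjoint I J → IsCup (cls _ hf) (cls _ hg) 0) := by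
  have hα : ∀ l ∈ I, cofactor k l * mon k α = 0 := fun l hl => by
    have := cofactor_mul_apply_eq_zero k hf hi hl
    rwa [apply_gen_std hi] at this
  have hβ : ∀ l ∈ J, cofactor k l * mon k β = 0 := fun l hl => by
    have := cofactor_mul_apply_eq_zero k hg hj hl
    rwa [apply_gen_std hj] at this
  obtain ⟨c, hc⟩ := exists_eq_varProd_mul k hα
  obtain ⟨φ, hφ, hφ'⟩ := exists_isLift_coch k hi
  have hlift : IsLift (std k i I p α) fun m => inclLeft k n c • φ m := by
    rw [std_eq_coch, hc, coch_mul]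
    exact hφ.smul _
  have hval : ∀ z : F k n (i + j), (std k j J q β ∘ₗ (inclLeft k n c • φ j)) z =
      if Disjoint I J then
        sgn J I • (mulMap k n (extend k n (i + j) z (I ∪ J, p + q)) * mon k (α + β))
      else 0 := by
    intro z
    rw [LinearMap.comp_apply, LinearMap.smul_apply, map_smul, std_eq_coch, hφ' J q j _ hj hβ,
      env_smul_def, mulMap_inclLeft]
    split_ifs with hd
    · rw [mul_smul_comm, mon_add, hc]
      congr 1
      ring
    · rw [mul_zero]
  refine ⟨fun hd => ?_, fun hd => ?_⟩
  · have hfg : std k (i + j) (I ∪ J) (p + q) (α + β) ∈ cocycles k n (i + j) := by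
      rw [std_eq_coch]
      refine coch_mem_cocycles k _ _ _ fun l hl => ?_
      rw [mon_add]
      rcases Finset.mem_union.1 hl with h | h
      · rw [← mul_assoc, hα l h, zero_mul]
      · rw [mul_left_comm, hβ l h, mul_zero]
    refine ⟨hfg, _, hf, _, hg, _, hlift, rfl, rfl, ?_⟩
    rw [zsmul_cls _ hfg (zsmul_mem hfg _)]
    refine cls_congr (LinearMap.ext fun z => ?_) _ _
    rw [hval, if_pos hd, std_eq_coch, coch_zsmul]
  · refine ⟨_, hf, _, hg, _, hlift, rfl, rfl, ?_⟩
    rw [cls_congr (f' := 0) (LinearMap.ext fun z => ?_) _ (Submodule.zero_mem _)]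
    · rfl
    · rw [hval, if_neg hd, LinearMap.zero_apply]

theorem exists_isCup {i j : ℕ} (a : HH k n i) (b : HH k n j) : ∃ c, IsCup a b c := by
  obtain ⟨⟨f, hf⟩, rfl⟩ := Submodule.Quotient.mk_surjective _ a
  obtain ⟨⟨g, hg⟩, rfl⟩ := Submodule.Quotient.mk_surjective _ b
  obtain ⟨φ, -, hφ, -, -⟩ := exists_isLift_comm hf hg
  exact ⟨_, f, hf, g, hg, φ, hφ, rfl, rfl, rfl⟩

/-- Graded commutativity of the cup product. -/
theorem IsCup.comm {i j : ℕ} {a : HH k n i} {b : HH k n j} {c : HH k n (i + j)}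
    (h : IsCup a b c) :
    IsCup b a ((-1 : ℤ) ^ (i * j) • HH.cast (Nat.add_comm i j) c) := by
  obtain ⟨⟨f, hf⟩, rfl⟩ := Submodule.Quotient.mk_surjective _ a
  obtain ⟨⟨g, hg⟩, rfl⟩ := Submodule.Quotient.mk_surjective _ b
  obtain ⟨φ, ψ, hφ, hψ, hcomm⟩ := exists_isLift_comm hf hg
  obtain rfl := h.unique ⟨f, hf, g, hg, φ, hφ, rfl, rfl, rfl⟩
  refine ⟨g, hg, f, hf, ψ, hψ, rfl, rfl, ?_⟩
  have hfψ := hψ.comp_mem hf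
  rw [cast_cls (Nat.add_comm i j) (hφ.comp_mem hg)
    (f' := (-1 : ℤ) ^ (i * j) • (f ∘ₗ ψ i)) (zsmul_mem hfψ _) hcomm,
    zsmul_cls _ _ (zsmul_mem (zsmul_mem hfψ _) _)]
  refine cls_congr ?_ _ _
  rw [smul_smul, ← mul_pow]
  simp

end Products
end SqfreeHH

theorem proposition4p1 (k : Type*) [Field k] (n : ℕ) :
    (∀ (i j : ℕ) (a : SqfreeHH.HH k n i) (b : SqfreeHH.HH k n j),
      ∃! c : SqfreeHH.HH k n (i + j), SqfreeHH.IsCup a b c) ∧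
    (∀ (I J : Finset (Fin n)) (p q i j : ℕ) (α β : Fin n →₀ ℕ)
      (_ : I.card + 2 * p = i) (_ : J.card + 2 * q = j)
      (hf : SqfreeHH.std k i I p α ∈ SqfreeHH.cocycles k n i)
      (hg : SqfreeHH.std k j J q β ∈ SqfreeHH.cocycles k n j),
      (I ∩ J = ∅ →
        (∃ hfg : SqfreeHH.std k (i + j) (I ∪ J) (p + q) (α + β) ∈ SqfreeHH.cocycles k n (i + j),
          SqfreeHH.IsCup (SqfreeHH.cls _ hf) (SqfreeHH.cls _ hg)
            (SqfreeHH.sgn J I • SqfreeHH.cls _ hfg)) ∧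
        SqfreeHH.sgn J I = (-1) ^ (i * j) * SqfreeHH.sgn I J) ∧
      (I ∩ J ≠ ∅ → SqfreeHH.IsCup (SqfreeHH.cls _ hf) (SqfreeHH.cls _ hg) 0)) ∧
    (∀ (i j : ℕ) (a : SqfreeHH.HH k n i) (b : SqfreeHH.HH k n j) (c : SqfreeHH.HH k n (i + j)),
      SqfreeHH.IsCup a b c →
        SqfreeHH.IsCup b a ((-1 : ℤ) ^ (i * j) • SqfreeHH.HH.cast (Nat.add_comm i j) c)) := by
  refine ⟨fun i j a b => ?_, fun I J p q i j α β hi hj hf hg => ⟨fun h => ?_, fun h => ?_⟩,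
    fun i j a b c h => h.comm⟩
  · obtain ⟨c, hc⟩ := SqfreeHH.exists_isCup a b
    exact ⟨c, hc, fun c' hc' => hc'.unique hc⟩
  · have hd := Finset.disjoint_iff_inter_eq_empty.2 h
    exact ⟨(SqfreeHH.isCup_std hi hj hf hg).1 hd, SqfreeHH.sgn_swap hd hi hj⟩
  · exact (SqfreeHH.isCup_std hi hj hf hg).2 fun hd =>
      h (Finset.disjoint_iff_inter_eq_empty.1 hd)
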